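/- Let $k$ be a commutative ring and let $A$ be a unital associative $k$-algebra with a $k$-linear involution $a\mapsto\overline a$ (so $\overline{ab}=\overline b\,\overline a$ and $\overline{\overline a}=a$). Let $\Delta H$ be the hyperoctahedral category: its objects are the sets $[n]=\{0,\dots,n\}$, $n\ge 0$, and a morphism $[n]\to[m]$ is a map of sets together with a total order on each fibre and a label $z_i\in C_2=\{1,t\}$ for each $i\in[n]$; in a composite $g\circ f$ the fibres of $f$ are concatenated in the order given by $g$, where a fibre carrying the label $t$ is reversed and all its labels are multiplied by $t$. Let $\Delta H_+$ be $\Delta H$ with an initial object $[-1]$ added. The hyperoctahedral bar construction is the functor $\mathsf H_{A+}\colon\Delta H_+\to \mathbf{Mod}_k$, $[n]\mapsto A^{\otimes (n+1)}$, $[-1]\mapsto k$, under which a morphism multiplies the factors $a_i$ (for $z_i=1$) or $\overline{a_i}$ (for $z_i=t$) in each fibre, in the order of the fibre; $\mathsf H_A$ is its restriction to $\Delta H$. Hyperoctahedral homology is $HO_n(A)=\mathrm{Tor}_n^{\Delta H}(k^\star,\mathsf H_A)$, with $k^\star$ the constant functor at $k$. Let $C_\star=C_\star(\Delta H_+,\mathsf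 H_{A+})$ be the simplicial $k$-module with $C_n=\bigoplus \mathsf H_{A+}(C_0)$, the sum being over all strings $C_0\xrightarrow{f_1}\cdots\xrightarrow{f_n}C_n$ in $\Delta H_+$, and let $H_\star(\Delta H_+,\mathsf H_{A+})$ be its homology. The Pontryagin product $$H_p(\Delta H_+,\mathsf H_{A+})\otimes H_q(\Delta H_+,\mathsf H_{A+})\to H_{p+q}(\Delta H_+,\mathsf H_{A+})$$ is induced, through the Eilenberg–Zilber shuffle map, by the map of simplicial modules $C_\star\otimes C_\star\to C_\star$, $$(f_n,\dots,f_1,x)\otimes(g_n,\dots,g_1,y)\mapsto (f_n\sqcup g_n,\dots,f_1\sqcup g_1,x\otimes y),$$ where $\sqcup$ is the disjoint union of morphisms. Then the canonical map $HO_0(A)\to k^\star\otimes_{\Delta H}\mathsf H_A\to H_0(\Delta H_+,\mathsf H_{A+})$, $[1\otimes x]\mapsto [x]$, is an isomorphism; identify the two modules along it, so that the Pontryagin product restricts to a product $HO_0(A)\otimes HO_0(A)\to HO_0(A)$. There is an isomorphism of $k$-modules $$\Phi\colon \frac{A}{(a_0a_1a_2-a_2\overline{a_1}a_0)}\xrightarrow{\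 \cong\ } HO_0(A),$$ where the denominator is the two-sided ideal generated by all the elements $a_0a_1a_2-a_2\overline{a_1}a_0$ with $a_0,a_1,a_2\in A$, which sends the class of $a\in A$ to the class of $a\in\mathsf H_{A+}([0])=A$ at the object $[0]$, and under $\Phi$ the Pontryagin product on $HO_0(A)$ is the multiplication of the quotient algebra: $\Phi(xy)=\Phi(x)\cdot\Phi(y)$ for all $x,y$. -/

import Mathlib

open CategoryTheory
open scoped TensorProduct

universe u

namespace HyperoctahedralHomology

noncomputable section

/-! ### The Eilenberg–Zilber shuffle chain -/

/-- Formal integral combinations of `n`-tuples of vertices (`n + 1` entries) of `ℕ × ℕ`. -/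
abbrev GridChain (n : ℕ) : Type := (Fin (n + 1) → ℕ × ℕ) →₀ ℤ

/-- Append the vertex `v` at the end of every tuple. -/
def gridCone {n : ℕ} (v : ℕ × ℕ) : GridChain n →ₗ[ℤ] GridChain (n + 1) :=
  Finsupp.lmapDomain ℤ ℤ (fun t => Fin.snoc (α := fun _ => ℕ × ℕ) t v)

/-- `ezChain p q n` is, for `n = p + q`, the sum of all maximal chains
`(0,0) = v₀ < v₁ < ⋯ < vₙ = (p,q)` of the poset `[p] × [q]` (that is, of all `(p,q)`-shuffles),
each with the sign of the shuffle: `(-1)` to the number of pairs consisting of a step in the second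
direction followed later by a step in the first direction.  It is zero if `n ≠ p + q`.
The recursion is over the last step of the chain. -/
def ezChain : (p q n : ℕ) → GridChain n
  | 0, 0, 0 => Finsupp.single (fun _ => (0, 0)) 1
  | _ + 1, _, 0 => 0
  | 0, _ + 1, 0 => 0
  | 0, 0, _ + 1 => 0
  | p + 1, 0, n + 1 => gridCone (p + 1, 0) (ezChain p 0 n)
  | 0, q + 1, n + 1 => gridCone (0, q + 1) (ezChain 0 q n)
  | p + 1, q + 1, n + 1 =>
      gridCone (p + 1, q + 1) ((-1 : ℤ) ^ (q + 1) • ezChain p (q + 1) n + ezChain (p + 1) q n)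

/-- The simplicial boundary of tuples. -/
def gridBoundary (n : ℕ) : GridChain (n + 1) →ₗ[ℤ] GridChain n :=
  ∑ i : Fin (n + 2), (-1 : ℤ) ^ (i : ℕ) • Finsupp.lmapDomain ℤ ℤ (fun t => t ∘ i.succAbove)

/-- The order embedding of `ℕ` that misses `i`. -/
def skip (i a : ℕ) : ℕ := if a < i then a else a + 1

def pushFst {n : ℕ} (i : ℕ) : GridChain n →ₗ[ℤ] GridChain n :=
  Finsupp.lmapDomain ℤ ℤ (fun t j => (skip i (t j).1, (t j).2))

def pushSnd {n : ℕ} (i : ℕ) : GridChain n →ₗ[ℤ] GridChain n :=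
  Finsupp.lmapDomain ℤ ℤ (fun t j => ((t j).1, skip i (t j).2))

/-- The tuples that are chains in `[p] × [q]`. -/
def GridGood (p q : ℕ) {n : ℕ} (t : Fin (n + 1) → ℕ × ℕ) : Prop :=
  Monotone t ∧ ∀ i, t i ≤ (p, q)

lemma ezChain_eq_zero (n p q : ℕ) (h : n ≠ p + q) : ezChain p q n = 0 := by
  induction n generalizing p q with
  | zero => rcases p with _ | p <;> rcases q with _ | q <;> simp_all [ezChain]
  | succ n ih =>
    rcases p with _ | p <;> rcases q with _ | q
    · simp [ezChain]
    · rw [ezChain, ih _ _ (by omega), map_zero]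
    · rw [ezChain, ih _ _ (by omega), map_zero]
    · rw [ezChain, ih _ _ (by omega), ih _ _ (by omega)]; simp

lemma gridCone_mem {n p q p' q' : ℕ} (hp : p' ≤ p) (hq : q' ≤ q) {c : GridChain n}
    (hc : c ∈ Finsupp.supported ℤ ℤ {t | GridGood p' q' t}) :
    gridCone (p, q) c ∈ Finsupp.supported ℤ ℤ {t | GridGood p q t} := by
  have := Finsupp.lmapDomain_supported ℤ ℤ
    (fun t : Fin (n + 1) → ℕ × ℕ => (Fin.snoc (α := fun _ => ℕ × ℕ) t (p, q) : Fin (n + 2) → ℕ × ℕ))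
    {t | GridGood p' q' t}
  have h2 : gridCone (p, q) c ∈ (Finsupp.supported ℤ ℤ {t | GridGood p' q' t}).map
    (gridCone (p, q)) := ⟨c, hc, rfl⟩
  rw [gridCone, this] at h2
  refine Finsupp.supported_mono ?_ h2
  rintro _ ⟨t, ⟨hm, hb⟩, rfl⟩
  have hb' : ∀ i, t i ≤ (p, q) := fun i => (hb i).trans ⟨hp, hq⟩
  constructor
  · intro i j hij
    induction j using Fin.lastCases with
    | last =>
      induction i using Fin.lastCases with
      | last => exact le_rfl
      | cast i => simpa using hb' i
    | cast j =>
      induction i using Fin.lastCases with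
      | last => exact absurd hij (by simp [Fin.le_iff_val_le_val]; omega)
      | cast i => simpa using hm hij
  · intro i
    refine Fin.lastCases ?_ (fun i => ?_) i
    · simp
    · simpa using hb' i

lemma ezChain_mem (n p q : ℕ) :
    ezChain p q n ∈ Finsupp.supported ℤ ℤ {t | GridGood p q t} := by
  induction n generalizing p q with
  | zero =>
    rcases p with _ | p <;> rcases q with _ | q <;> simp only [ezChain, Submodule.zero_mem]
    exact Finsupp.single_mem_supported _ _ ⟨fun _ _ _ => le_rfl, fun _ => le_rfl⟩
  | succ n ih =>
    rcases p with _ | p <;> rcases q with _ | q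
    · simp [ezChain]
    · exact gridCone_mem le_rfl (Nat.le_succ q) (ih _ _)
    · exact gridCone_mem (Nat.le_succ p) le_rfl (ih _ _)
    · rw [ezChain, map_add, map_smul]
      exact Submodule.add_mem _
        (Submodule.smul_mem _ _ (gridCone_mem (Nat.le_succ p) le_rfl (ih _ _)))
        (gridCone_mem le_rfl (Nat.le_succ q) (ih _ _))

lemma supported_linearMap_ext {ι M : Type*} [AddCommGroup M] {s : Set ι} {f g : (ι →₀ ℤ) →ₗ[ℤ] M}
    (h : ∀ t ∈ s, f (Finsupp.single t 1) = g (Finsupp.single t 1)) {c : ι →₀ ℤ}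
    (hc : c ∈ Finsupp.supported ℤ ℤ s) : f c = g c := by
  rw [Finsupp.supported_eq_span_single] at hc
  exact LinearMap.eqOn_span (by rintro _ ⟨t, ht, rfl⟩; exact h t ht) hc

lemma gridBoundary_cone (n : ℕ) (v : ℕ × ℕ) (c : GridChain (n + 1)) :
    gridBoundary (n + 1) (gridCone v c) =
      gridCone v (gridBoundary n c) + (-1 : ℤ) ^ n • c := by
  have : gridBoundary (n + 1) ∘ₗ gridCone v =
      gridCone v ∘ₗ gridBoundary n + (-1 : ℤ) ^ n • LinearMap.id := by
    ext1 t
    ext1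
    simp only [gridBoundary, gridCone, LinearMap.comp_apply, LinearMap.add_apply,
      LinearMap.smul_apply, LinearMap.id_apply, LinearMap.sum_apply, map_sum, map_smul,
      Finsupp.lsingle_apply, Finsupp.lmapDomain_apply, Finsupp.mapDomain_single]
    rw [Fin.sum_univ_castSucc]
    congr 1
    · refine Finset.sum_congr rfl fun i _ => ?_
      congr 2
      funext j
      refine Fin.lastCases ?_ (fun j => ?_) j
      · simp
      · simp [Fin.castSucc_succAbove_castSucc]
    · have : ((-1 : ℤ) ^ ((Fin.last (n + 2) : Fin (n + 3)) : ℕ)) = (-1) ^ n := by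
        simp [pow_succ]
      rw [this]
      congr 2
      funext j
      simp
  exact LinearMap.congr_fun this c

lemma pushFst_cone {n : ℕ} (i : ℕ) (v : ℕ × ℕ) (c : GridChain n) :
    pushFst i (gridCone v c) = gridCone (skip i v.1, v.2) (pushFst i c) := by
  have : pushFst i ∘ₗ gridCone v = gridCone (skip i v.1, v.2) ∘ₗ pushFst (n := n) i := by
    ext1 t
    ext1
    simp only [pushFst, gridCone, LinearMap.comp_apply,
      Finsupp.lsingle_apply, Finsupp.lmapDomain_apply, Finsupp.mapDomain_single]
    congr 1
    funext j
    refine Fin.lastCases ?_ (fun j => ?_) j <;> simp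
  exact LinearMap.congr_fun this c

lemma pushSnd_cone {n : ℕ} (i : ℕ) (v : ℕ × ℕ) (c : GridChain n) :
    pushSnd i (gridCone v c) = gridCone (v.1, skip i v.2) (pushSnd i c) := by
  have : pushSnd i ∘ₗ gridCone v = gridCone (v.1, skip i v.2) ∘ₗ pushSnd (n := n) i := by
    ext1 t
    ext1
    simp only [pushSnd, gridCone, LinearMap.comp_apply,
      Finsupp.lsingle_apply, Finsupp.lmapDomain_apply, Finsupp.mapDomain_single]
    congr 1
    funext j
    refine Fin.lastCases ?_ (fun j => ?_) j <;> simp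
  exact LinearMap.congr_fun this c

lemma pushFst_ezChain (p q n : ℕ) : pushFst (p + 1) (ezChain p q n) = ezChain p q n := by
  refine supported_linearMap_ext (f := pushFst (p + 1)) (g := LinearMap.id) ?_ (ezChain_mem n p q)
  rintro t ⟨-, hb⟩
  simp only [pushFst, LinearMap.id_apply, Finsupp.lmapDomain_apply, Finsupp.mapDomain_single]
  congr 1
  funext j
  have := (hb j).1
  simp only [skip]
  rw [if_pos (by simp at this; omega)]

lemma pushSnd_ezChain (p q n : ℕ) : pushSnd (q + 1) (ezChain p q n) = ezChain p q n := by
  refine supported_linearMap_ext (f := pushSnd (q + 1)) (g := LinearMap.id) ?_ (ezChain_mem n p q)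
  rintro t ⟨-, hb⟩
  simp only [pushSnd, LinearMap.id_apply, Finsupp.lmapDomain_apply, Finsupp.mapDomain_single]
  congr 1
  funext j
  have := (hb j).2
  simp only [skip]
  rw [if_pos (by simp at this; omega)]

/-- The alternating sum of the faces of the first factor. -/
def ezFst : (p q n : ℕ) → GridChain n
  | 0, _, _ => 0
  | p + 1, q, n => ∑ i ∈ Finset.range (p + 2), (-1 : ℤ) ^ i • pushFst i (ezChain p q n)

/-- The alternating sum of the faces of the second factor. -/
def ezSnd : (p q n : ℕ) → GridChain n
  | _, 0, _ => 0
  | p, q + 1, n => ∑ j ∈ Finset.range (q + 2), (-1 : ℤ) ^ j • pushSnd j (ezChain p q n)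

/-- The part of `ezFst` in which the last vertex is not removed. -/
def ezFst' : (p q n : ℕ) → GridChain n
  | 0, _, _ => 0
  | p + 1, q, n => ∑ i ∈ Finset.range (p + 1), (-1 : ℤ) ^ i • pushFst i (ezChain p q n)

def ezSnd' : (p q n : ℕ) → GridChain n
  | _, 0, _ => 0
  | p, q + 1, n => ∑ j ∈ Finset.range (q + 1), (-1 : ℤ) ^ j • pushSnd j (ezChain p q n)

lemma ezFst_succ (p q n : ℕ) :
    ezFst (p + 1) q n = ezFst' (p + 1) q n + (-1 : ℤ) ^ (p + 1) • ezChain p q n := by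
  rw [ezFst, Finset.sum_range_succ, pushFst_ezChain, ezFst']

lemma ezSnd_succ (p q n : ℕ) :
    ezSnd p (q + 1) n = ezSnd' p (q + 1) n + (-1 : ℤ) ^ (q + 1) • ezChain p q n := by
  rw [ezSnd, Finset.sum_range_succ, pushSnd_ezChain, ezSnd']

/-- Lower faces of a cone. -/
lemma ezFst'_cone (p q n : ℕ) (hpq : p + q = n + 1) :
    ezFst' (p + 1) q (n + 1) = gridCone (p + 1, q)
      ((-1 : ℤ) ^ q • ezFst p q n + (match q with
        | 0 => 0
        | q + 1 => ezFst' (p + 1) q n + 0)) := by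
  rcases p with _ | p <;> rcases q with _ | q
  · omega
  · simp [ezFst', ezFst, ezChain, pushFst_cone, skip]
  · simp [ezFst', ezFst, ezChain, pushFst_cone, skip]
    refine Finset.sum_congr rfl fun i hi => ?_
    rw [if_neg (by simp at hi; omega)]
  · simp only [ezFst', ezFst, ezChain, pushFst_cone, skip, map_add, map_smul, map_sum,
      Finset.smul_sum, smul_add, Finset.sum_add_distrib, add_zero]
    congr 1
    · refine Finset.sum_congr rfl fun i hi => ?_
      rw [if_neg (by simp at hi; omega), smul_comm]
    · refine Finset.sum_congr rfl fun i hi => ?_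
      rw [if_neg (by simp at hi; omega)]

lemma ezSnd'_cone (p q n : ℕ) (hpq : p + q = n + 1) :
    ezSnd' p (q + 1) (n + 1) = gridCone (p, q + 1)
      (ezSnd p q n + (match p with
        | 0 => 0
        | p + 1 => (-1 : ℤ) ^ q • ezSnd' p (q + 1) n)) := by
  rcases p with _ | p <;> rcases q with _ | q
  · omega
  · simp [ezSnd', ezSnd, ezChain, pushSnd_cone, skip]
    refine Finset.sum_congr rfl fun i hi => ?_
    rw [if_neg (by simp at hi; omega)]
  · simp [ezSnd', ezSnd, ezChain, pushSnd_cone, skip]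
  · simp only [ezSnd', ezSnd, ezChain, pushSnd_cone, skip, map_add, map_smul, map_sum,
      Finset.smul_sum, smul_add, Finset.sum_add_distrib]
    refine (add_comm _ _).trans ?_
    congr 1
    · refine Finset.sum_congr rfl fun i hi => ?_
      rw [if_neg (by simp at hi; omega)]
    · refine Finset.sum_congr rfl fun i hi => ?_
      rw [if_neg (by simp at hi; omega), smul_comm]

/-- The Leibniz rule for the shuffle chains. -/
lemma gridBoundary_ezChain (n p q : ℕ) :
    gridBoundary n (ezChain p q (n + 1)) = ezFst p q n + (-1 : ℤ) ^ p • ezSnd p q n := by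
  induction n generalizing p q with
  | zero =>
    by_cases hpq : p + q = 1
    · obtain ⟨rfl, rfl⟩ | ⟨rfl, rfl⟩ : (p = 0 ∧ q = 1) ∨ (p = 1 ∧ q = 0) := by omega
      all_goals
        simp [ezChain, gridBoundary, gridCone, ezFst, ezSnd, pushFst, pushSnd,
          Finset.sum_range_succ, Fin.sum_univ_two, Finsupp.mapDomain_single, skip]
        congr 2
        refine congrArg (fun t => Finsupp.single t (1 : ℤ)) ?_
        funext j
        fin_cases j
        simp [Fin.snoc]
    · rw [ezChain_eq_zero _ _ _ (by omega), map_zero]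
      rcases p with _ | p <;> rcases q with _ | q <;> simp only [ezFst, ezSnd]
      · simp
      · rw [ezChain_eq_zero _ _ _ (by omega)]; simp
      · rw [ezChain_eq_zero _ _ _ (by omega)]; simp
      · rw [ezChain_eq_zero _ _ _ (by omega), ezChain_eq_zero _ _ _ (by omega)]; simp
  | succ n ih =>
    by_cases hpq : p + q = n + 2
    · rcases p with _ | p <;> rcases q with _ | q
      · omega
      · obtain rfl : q = n + 1 := by omega
        rw [ezChain, gridBoundary_cone, ih, ezSnd_succ 0 (n + 1) (n + 1), ezSnd'_cone _ _ _ (by omega)]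
        simp [ezFst, pow_succ]
      · obtain rfl : p = n + 1 := by omega
        rw [ezChain, gridBoundary_cone, ih, ezFst_succ (n + 1) 0 (n + 1), ezFst'_cone _ _ _ (by omega)]
        simp [ezSnd, pow_succ]
      · obtain rfl : n = p + q := by omega
        rw [ezChain, gridBoundary_cone, map_add, map_smul, ih, ih, ezFst_succ p (q + 1),
          ezFst'_cone _ _ _ (by omega), ezSnd_succ (p + 1) q, ezSnd'_cone _ _ _ (by omega),
          ezFst_succ, ezSnd_succ p q]
        simp only [map_add, map_smul, add_zero]
        have h1 : ((-1 : ℤ) ^ q) * (-1) ^ q = 1 := by rw [← mul_pow]; simp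
        simp only [pow_succ, pow_add]
        match_scalars <;> first | ring1 | linear_combination (-1) ^ p * h1 |
          linear_combination (-1 : ℤ) * (-1) ^ p * h1
    · rw [ezChain_eq_zero _ _ _ (by omega), map_zero]
      rcases p with _ | p <;> rcases q with _ | q <;> simp only [ezFst, ezSnd]
      · simp
      · rw [ezChain_eq_zero _ _ _ (by omega)]; simp
      · rw [ezChain_eq_zero _ _ _ (by omega)]; simp
      · rw [ezChain_eq_zero _ _ _ (by omega), ezChain_eq_zero _ _ _ (by omega)]; simp

/-! ### Products on the homology of a simplicial module -/

open Simplicial Opposite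

variable {k : Type u} [CommRing k]

section Product

/-- A morphism of simplicial `k`-modules `X ⊗ X ⟶ X`, where `⊗` is the levelwise tensor product,
given as a natural family of bilinear maps. -/
structure SimplicialProduct (X : SimplicialObject (ModuleCat.{u} k)) where
  mul : ∀ n : SimplexCategoryᵒᵖ, X.obj n →ₗ[k] X.obj n →ₗ[k] X.obj n
  map_mul : ∀ {n m : SimplexCategoryᵒᵖ} (f : n ⟶ m) (x y : X.obj n),
    X.map f (mul n x y) = mul m (X.map f x) (X.map f y)

variable {X : SimplicialObject (ModuleCat.{u} k)} (P : SimplicialProduct X)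

/-- The first coordinate of a chain in `[p] × [q]`, as a morphism `[n] ⟶ [p]`. -/
def gridFst {p q n : ℕ} {t : Fin (n + 1) → ℕ × ℕ} (ht : GridGood p q t) : ⦋n⦌ ⟶ ⦋p⦌ :=
  SimplexCategory.mkHom
    ⟨fun i => ⟨(t i).1, Nat.lt_succ_of_le (ht.2 i).1⟩, fun _ _ hij => (ht.1 hij).1⟩

/-- The second coordinate of a chain in `[p] × [q]`, as a morphism `[n] ⟶ [q]`. -/
def gridSnd {p q n : ℕ} {t : Fin (n + 1) → ℕ × ℕ} (ht : GridGood p q t) : ⦋n⦌ ⟶ ⦋q⦌ :=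
  SimplexCategory.mkHom
    ⟨fun i => ⟨(t i).2, Nat.lt_succ_of_le (ht.2 i).2⟩, fun _ _ hij => (ht.1 hij).2⟩

open Classical in
/-- For a chain `t = (α, β) : [n] → [p] × [q]` the bilinear map `(x, y) ↦ α^*(x) · β^*(y)`. -/
def tupleProduct (p q n : ℕ) (t : Fin (n + 1) → ℕ × ℕ) :
    X _⦋p⦌ →ₗ[k] X _⦋q⦌ →ₗ[k] X _⦋n⦌ :=
  if ht : GridGood p q t then
    (P.mul (op ⦋n⦌)).compl₁₂ (X.map (gridFst ht).op).hom (X.map (gridSnd ht).op).hom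
  else 0

/-- Evaluation of formal combinations of chains. -/
def gridEval (p q n : ℕ) : GridChain n →ₗ[ℤ] (X _⦋p⦌ →ₗ[k] X _⦋q⦌ →ₗ[k] X _⦋n⦌) :=
  Finsupp.linearCombination ℤ (tupleProduct P p q n)

/-- The product of chains `X_p × X_q → X_{p+q}`: the composite of the Eilenberg–Zilber shuffle map
with the product of `X`, i.e. the sum over `(p,q)`-shuffles of `± s_ν(x) · s_μ(y)`. -/
def chainProduct (p q n : ℕ) : X _⦋p⦌ →ₗ[k] X _⦋q⦌ →ₗ[k] X _⦋n⦌ :=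
  gridEval P p q n (ezChain p q n)

/-- The alternating sum of the face maps. -/
def simplicialD (X : SimplicialObject (ModuleCat.{u} k)) (n : ℕ) : X _⦋n + 1⦌ →ₗ[k] X _⦋n⦌ :=
  ∑ i : Fin (n + 2), (-1 : ℤ) ^ (i : ℕ) • (X.δ i).hom

lemma simplicialD_zero (X : SimplicialObject (ModuleCat.{u} k)) (x : X _⦋0 + 1⦌) :
    simplicialD X 0 x = X.δ 0 x - X.δ 1 x := by
  rw [simplicialD, Fin.sum_univ_two, LinearMap.add_apply, LinearMap.smul_apply,
    LinearMap.smul_apply]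
  simp [sub_eq_add_neg]

lemma gridEval_single (p q n : ℕ) (t : Fin (n + 1) → ℕ × ℕ) (ht : GridGood p q t)
    (x : X _⦋p⦌) (y : X _⦋q⦌) :
    gridEval P p q n (Finsupp.single t 1) x y =
      P.mul (op ⦋n⦌) (X.map (gridFst ht).op x) (X.map (gridSnd ht).op y) := by
  simp [gridEval, tupleProduct, ht]

/-- In degree zero the product of chains is the product of `X`. -/
lemma chainProduct_zero (x y : X _⦋0⦌) : chainProduct P 0 0 0 x y = P.mul (op ⦋0⦌) x y := by
  have hg : GridGood 0 0 (fun _ : Fin 1 => ((0, 0) : ℕ × ℕ)) :=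
    ⟨fun _ _ _ => le_rfl, fun _ => le_rfl⟩
  have h1 : gridFst hg = 𝟙 _ := by ext i; simp [gridFst]
  have h2 : gridSnd hg = 𝟙 _ := by ext i; simp [gridSnd]
  rw [chainProduct, ezChain, gridEval_single P _ _ _ _ hg, h1, h2]
  simp only [op_id, CategoryTheory.Functor.map_id]
  rfl

lemma gridEval_comp (p q n : ℕ) (t : Fin (n + 2) → ℕ × ℕ) (ht : GridGood p q t) (i : Fin (n + 2))
    (x : X _⦋p⦌) (y : X _⦋q⦌) :
    gridEval P p q n (Finsupp.single (t ∘ i.succAbove) 1) x y =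
      X.δ i (gridEval P p q (n + 1) (Finsupp.single t 1) x y) := by
  have ht' : GridGood p q (t ∘ i.succAbove) :=
    ⟨ht.1.comp (Fin.strictMono_succAbove i).monotone, fun j => ht.2 _⟩
  rw [gridEval_single P _ _ _ _ ht', gridEval_single P _ _ _ _ ht]
  have h1 : gridFst ht' = SimplexCategory.δ i ≫ gridFst ht := rfl
  have h2 : gridSnd ht' = SimplexCategory.δ i ≫ gridSnd ht := rfl
  rw [h1, h2, op_comp, op_comp, X.map_comp, X.map_comp]
  exact (P.map_mul (SimplexCategory.δ i).op _ _).symm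

lemma gridEval_pushFst (p q n : ℕ) (t : Fin (n + 1) → ℕ × ℕ) (ht : GridGood p q t)
    (i : Fin (p + 2)) (x : X _⦋p + 1⦌) (y : X _⦋q⦌) :
    gridEval P (p + 1) q n (pushFst i (Finsupp.single t 1)) x y =
      gridEval P p q n (Finsupp.single t 1) (X.δ i x) y := by
  have hmono : Monotone (skip (i : ℕ)) := by
    intro a b hab
    simp only [skip]
    split_ifs <;> omega
  have ht' : GridGood (p + 1) q (fun j => (skip i (t j).1, (t j).2)) := by
    refine ⟨fun a b hab => ⟨hmono (ht.1 hab).1, (ht.1 hab).2⟩, fun j => ⟨?_, (ht.2 j).2⟩⟩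
    have := (ht.2 j).1
    simp only [skip] at this ⊢
    split_ifs <;> omega
  rw [pushFst, Finsupp.lmapDomain_apply, Finsupp.mapDomain_single,
    gridEval_single P _ _ _ _ ht', gridEval_single P _ _ _ _ ht]
  have h1 : gridFst ht' = gridFst ht ≫ SimplexCategory.δ i := by
    ext j
    change skip i (t j).1 = ((i.succAbove ⟨(t j).1, _⟩ : Fin _) : ℕ)
    simp only [skip, Fin.succAbove, Fin.lt_def, Fin.val_castSucc]
    split_ifs <;> rfl
  have h2 : gridSnd ht' = gridSnd ht := rfl
  rw [h1, h2, op_comp, X.map_comp]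
  rfl

lemma gridEval_pushSnd (p q n : ℕ) (t : Fin (n + 1) → ℕ × ℕ) (ht : GridGood p q t)
    (i : Fin (q + 2)) (x : X _⦋p⦌) (y : X _⦋q + 1⦌) :
    gridEval P p (q + 1) n (pushSnd i (Finsupp.single t 1)) x y =
      gridEval P p q n (Finsupp.single t 1) x (X.δ i y) := by
  have hmono : Monotone (skip (i : ℕ)) := by
    intro a b hab
    simp only [skip]
    split_ifs <;> omega
  have ht' : GridGood p (q + 1) (fun j => ((t j).1, skip i (t j).2)) := by
    refine ⟨fun a b hab => ⟨(ht.1 hab).1, hmono (ht.1 hab).2⟩, fun j => ⟨(ht.2 j).1, ?_⟩⟩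
    have := (ht.2 j).2
    simp only [skip] at this ⊢
    split_ifs <;> omega
  rw [pushSnd, Finsupp.lmapDomain_apply, Finsupp.mapDomain_single,
    gridEval_single P _ _ _ _ ht', gridEval_single P _ _ _ _ ht]
  have h1 : gridSnd ht' = gridSnd ht ≫ SimplexCategory.δ i := by
    ext j
    change skip i (t j).2 = ((i.succAbove ⟨(t j).2, _⟩ : Fin _) : ℕ)
    simp only [skip, Fin.succAbove, Fin.lt_def, Fin.val_castSucc]
    split_ifs <;> rfl
  have h2 : gridFst ht' = gridFst ht := rfl
  rw [h1, h2, op_comp, X.map_comp]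
  rfl

lemma gridEval_boundary (p q n : ℕ) (x : X _⦋p⦌) (y : X _⦋q⦌) {c : GridChain (n + 1)}
    (hc : c ∈ Finsupp.supported ℤ ℤ {t | GridGood p q t}) :
    gridEval P p q n (gridBoundary n c) x y =
      simplicialD X n (gridEval P p q (n + 1) c x y) := by
  let ev (m : ℕ) : (X _⦋p⦌ →ₗ[k] X _⦋q⦌ →ₗ[k] X _⦋m⦌) →ₗ[ℤ] X _⦋m⦌ :=
    { toFun f := f x y, map_add' _ _ := rfl, map_smul' _ _ := rfl }
  refine supported_linearMap_ext (f := ev n ∘ₗ gridEval P p q n ∘ₗ gridBoundary n)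
    (g := (simplicialD X n).restrictScalars ℤ ∘ₗ ev (n + 1) ∘ₗ gridEval P p q (n + 1)) ?_ hc
  intro t ht
  have := gridEval_comp P p q n t ht
  simp only [ev, LinearMap.comp_apply, gridBoundary, LinearMap.sum_apply, LinearMap.smul_apply,
    Finsupp.lmapDomain_apply, Finsupp.mapDomain_single, map_sum, map_smul, LinearMap.coe_mk,
    AddHom.coe_mk, simplicialD, LinearMap.restrictScalars_apply, this]

lemma gridEval_ezFst_succ (p q n : ℕ) (x : X _⦋p + 1⦌) (y : X _⦋q⦌) :
    gridEval P (p + 1) q n (ezFst (p + 1) q n) x y =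
      chainProduct P p q n (simplicialD X p x) y := by
  have h (i : Fin (p + 2)) : gridEval P (p + 1) q n (pushFst i (ezChain p q n)) x y =
      chainProduct P p q n (X.δ i x) y := by
    let ev (r s m : ℕ) (x : X _⦋r⦌) (y : X _⦋s⦌) :
        (X _⦋r⦌ →ₗ[k] X _⦋s⦌ →ₗ[k] X _⦋m⦌) →ₗ[ℤ] X _⦋m⦌ :=
      { toFun f := f x y, map_add' _ _ := rfl, map_smul' _ _ := rfl }
    exact supported_linearMap_ext (f := ev _ _ _ x y ∘ₗ gridEval P (p + 1) q n ∘ₗ pushFst i)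
      (g := ev _ _ _ (X.δ i x) y ∘ₗ gridEval P p q n)
      (fun t ht => gridEval_pushFst P p q n t ht i x y) (ezChain_mem n p q)
  rw [ezFst, Finset.sum_range]
  simp only [map_sum, map_smul, LinearMap.sum_apply, LinearMap.smul_apply, h, simplicialD,
    map_zsmul]

lemma gridEval_ezSnd_succ (p q n : ℕ) (x : X _⦋p⦌) (y : X _⦋q + 1⦌) :
    gridEval P p (q + 1) n (ezSnd p (q + 1) n) x y =
      chainProduct P p q n x (simplicialD X q y) := by
  have h (i : Fin (q + 2)) : gridEval P p (q + 1) n (pushSnd i (ezChain p q n)) x y =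
      chainProduct P p q n x (X.δ i y) := by
    let ev (r s m : ℕ) (x : X _⦋r⦌) (y : X _⦋s⦌) :
        (X _⦋r⦌ →ₗ[k] X _⦋s⦌ →ₗ[k] X _⦋m⦌) →ₗ[ℤ] X _⦋m⦌ :=
      { toFun f := f x y, map_add' _ _ := rfl, map_smul' _ _ := rfl }
    exact supported_linearMap_ext (f := ev _ _ _ x y ∘ₗ gridEval P p (q + 1) n ∘ₗ pushSnd i)
      (g := ev _ _ _ x (X.δ i y) ∘ₗ gridEval P p q n)
      (fun t ht => gridEval_pushSnd P p q n t ht i x y) (ezChain_mem n p q)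
  rw [ezSnd, Finset.sum_range]
  simp only [map_sum, map_smul, LinearMap.sum_apply, LinearMap.smul_apply, h, simplicialD,
    map_zsmul]

/-- The simplicial chain complex: the alternating face map complex of `X`. -/
abbrev chains (X : SimplicialObject (ModuleCat.{u} k)) : ChainComplex (ModuleCat.{u} k) ℕ :=
  (AlgebraicTopology.alternatingFaceMapComplex (ModuleCat.{u} k)).obj X

lemma chains_d (X : SimplicialObject (ModuleCat.{u} k)) (n : ℕ) :
    ((chains X).d (n + 1) n).hom = simplicialD X n := by
  simp only [chains, AlgebraicTopology.alternatingFaceMapComplex_obj_d,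
    AlgebraicTopology.AlternatingFaceMapComplex.objD, simplicialD]
  ext x
  simp

/-- `x` is a cycle. -/
def IsCycle (X : SimplicialObject (ModuleCat.{u} k)) {n : ℕ} (x : X _⦋n⦌) : Prop :=
  match n, x with
  | 0, _ => True
  | n + 1, x => simplicialD X n x = 0

lemma leibniz (n p q : ℕ) (x : X _⦋p⦌) (y : X _⦋q⦌) :
    simplicialD X n (chainProduct P p q (n + 1) x y) =
      gridEval P p q n (ezFst p q n) x y + (-1 : ℤ) ^ p • gridEval P p q n (ezSnd p q n) x y := by
  rw [chainProduct, ← gridEval_boundary P _ _ _ _ _ (ezChain_mem _ _ _), gridBoundary_ezChain,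
    map_add, map_smul]
  rfl

lemma gridEval_ezFst_cycle {p : ℕ} (q n : ℕ) {x : X _⦋p⦌} (hx : IsCycle X x) (y : X _⦋q⦌) :
    gridEval P p q n (ezFst p q n) x y = 0 := by
  rcases p with _ | p
  · simp [ezFst]
  · rw [gridEval_ezFst_succ, show simplicialD X p x = 0 from hx]; simp

lemma gridEval_ezSnd_cycle (p : ℕ) {q : ℕ} (n : ℕ) (x : X _⦋p⦌) {y : X _⦋q⦌} (hy : IsCycle X y) :
    gridEval P p q n (ezSnd p q n) x y = 0 := by
  rcases q with _ | q
  · simp [ezSnd]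
  · rw [gridEval_ezSnd_succ, show simplicialD X q y = 0 from hy]; simp

lemma chainProduct_cycle {p q : ℕ} (n : ℕ) {x : X _⦋p⦌} {y : X _⦋q⦌}
    (hx : IsCycle X x) (hy : IsCycle X y) : IsCycle X (chainProduct P p q n x y) := by
  rcases n with _ | n
  · trivial
  · change simplicialD X n _ = 0
    rw [leibniz, gridEval_ezFst_cycle P _ _ hx, gridEval_ezSnd_cycle P _ _ _ hy]; simp

lemma chainProduct_boundary_left {p q : ℕ} (n : ℕ) (x : X _⦋p + 1⦌) {y : X _⦋q⦌}
    (hy : IsCycle X y) :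
    ∃ z, simplicialD X n z = chainProduct P p q n (simplicialD X p x) y := by
  refine ⟨chainProduct P (p + 1) q (n + 1) x y, ?_⟩
  rw [leibniz, gridEval_ezFst_succ, gridEval_ezSnd_cycle P _ _ _ hy]; simp

lemma chainProduct_boundary_right {p q : ℕ} (n : ℕ) {x : X _⦋p⦌} (y : X _⦋q + 1⦌)
    (hx : IsCycle X x) :
    ∃ z, simplicialD X n z = chainProduct P p q n x (simplicialD X q y) := by
  refine ⟨(-1 : ℤ) ^ p • chainProduct P p (q + 1) (n + 1) x y, ?_⟩
  rw [map_zsmul, leibniz, gridEval_ezSnd_succ, gridEval_ezFst_cycle P _ _ hx, zero_add, smul_smul,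
    ← mul_pow]
  simp

/-- The differential out of degree `n` of the chain complex. -/
lemma mem_ker_iff (n : ℕ) (x : X _⦋n⦌) :
    x ∈ LinearMap.ker ((chains X).sc n).g.hom ↔ IsCycle X x := by
  rcases n with _ | n
  · have : ((chains X).sc 0).g = 0 := (chains X).shape _ _ (by simp)
    simp only [IsCycle, iff_true, this]
    rfl
  · have key : ∀ m, m = n → (((chains X).d (n + 1) m).hom x = 0 ↔ IsCycle X x) := by
      rintro m rfl
      rw [chains_d]; rfl
    exact key _ (by simp)

lemma mem_range_iff (n : ℕ) (x : LinearMap.ker ((chains X).sc n).g.hom) :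
    x ∈ LinearMap.range ((chains X).sc n).moduleCatToCycles ↔ ∃ z, simplicialD X n z = x.1 := by
  have key : ∀ m, m = n + 1 → ((∃ z, ((chains X).d m n).hom z = x.1) ↔
      ∃ z, simplicialD X n z = x.1) := by
    rintro m rfl
    rw [chains_d]; rfl
  rw [← key _ (ChainComplex.prev ℕ n)]
  constructor
  · rintro ⟨z, hz⟩
    exact ⟨z, congrArg Subtype.val hz⟩
  · rintro ⟨z, hz⟩
    exact ⟨z, Subtype.ext hz⟩

/-- Homology as cycles modulo boundaries. -/
def homologyEquiv (X : SimplicialObject (ModuleCat.{u} k)) (n : ℕ) :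
    (chains X).homology n ≃ₗ[k] (LinearMap.ker ((chains X).sc n).g.hom ⧸
      LinearMap.range ((chains X).sc n).moduleCatToCycles) :=
  ((chains X).sc n).moduleCatHomologyIso.toLinearEquiv

/-- The homology class of a cycle. -/
def homologyClass (X : SimplicialObject (ModuleCat.{u} k)) (n : ℕ) :
    LinearMap.ker ((chains X).sc n).g.hom →ₗ[k] (chains X).homology n :=
  (homologyEquiv X n).symm.toLinearMap ∘ₗ
    (LinearMap.range ((chains X).sc n).moduleCatToCycles).mkQ

/-- The product of cycles. -/
def cycleProduct (p q n : ℕ) :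
    LinearMap.ker ((chains X).sc p).g.hom →ₗ[k] LinearMap.ker ((chains X).sc q).g.hom →ₗ[k]
      LinearMap.ker ((chains X).sc n).g.hom :=
  LinearMap.mk₂ k
    (fun x y => ⟨chainProduct P p q n x.1 y.1, (mem_ker_iff n _).2 (chainProduct_cycle P n
      ((mem_ker_iff p _).1 x.2) ((mem_ker_iff q _).1 y.2))⟩)
    (fun x x' y => Subtype.ext
      (LinearMap.congr_fun ((chainProduct P p q n).map_add x.1 x'.1) y.1))
    (fun c x y => Subtype.ext (LinearMap.congr_fun ((chainProduct P p q n).map_smul c x.1) y.1))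
    (fun x y y' => Subtype.ext ((chainProduct P p q n x.1).map_add y.1 y'.1))
    (fun c x y => Subtype.ext ((chainProduct P p q n x.1).map_smul c y.1))

lemma homologyClass_boundary (n : ℕ) (w : LinearMap.ker ((chains X).sc n).g.hom)
    (h : ∃ z, simplicialD X n z = w.1) : homologyClass X n w = 0 := by
  rw [homologyClass, LinearMap.comp_apply, Submodule.mkQ_apply,
    (Submodule.Quotient.mk_eq_zero _).2 ((mem_range_iff n w).2 h), map_zero]

lemma cycleProduct_boundary_left (p q n : ℕ) (x : LinearMap.ker ((chains X).sc p).g.hom)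
    (y : LinearMap.ker ((chains X).sc q).g.hom)
    (hx : x ∈ LinearMap.range ((chains X).sc p).moduleCatToCycles) :
    homologyClass X n (cycleProduct P p q n x y) = 0 := by
  obtain ⟨z, hz⟩ := (mem_range_iff p x).1 hx
  obtain ⟨w, hw⟩ := chainProduct_boundary_left P n z ((mem_ker_iff q _).1 y.2)
  exact homologyClass_boundary n _ ⟨w, hw.trans (by rw [hz]; rfl)⟩

lemma cycleProduct_boundary_right (p q n : ℕ) (x : LinearMap.ker ((chains X).sc p).g.hom)
    (y : LinearMap.ker ((chains X).sc q).g.hom)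
    (hy : y ∈ LinearMap.range ((chains X).sc q).moduleCatToCycles) :
    homologyClass X n (cycleProduct P p q n x y) = 0 := by
  obtain ⟨z, hz⟩ := (mem_range_iff q y).1 hy
  obtain ⟨w, hw⟩ := chainProduct_boundary_right P n z ((mem_ker_iff p _).1 x.2)
  exact homologyClass_boundary n _ ⟨w, hw.trans (by rw [hz]; rfl)⟩

/-- The product on homology in terms of the quotients cycles modulo boundaries. -/
def quotientProduct (p q n : ℕ) :
    (LinearMap.ker ((chains X).sc p).g.hom ⧸
        LinearMap.range ((chains X).sc p).moduleCatToCycles) →ₗ[k]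
      (LinearMap.ker ((chains X).sc q).g.hom ⧸
        LinearMap.range ((chains X).sc q).moduleCatToCycles) →ₗ[k] (chains X).homology n :=
  Submodule.liftQ _
    (LinearMap.flip (Submodule.liftQ _
      (LinearMap.flip ((cycleProduct P p q n).compr₂ (homologyClass X n)))
      (fun y hy => LinearMap.ext fun x => cycleProduct_boundary_right P p q n x y hy)))
    (fun x hx => LinearMap.ext fun y => by
      obtain ⟨y, rfl⟩ := Submodule.mkQ_surjective _ y
      exact cycleProduct_boundary_left P p q n x y hx)

/-- The product `H_p(X) × H_q(X) → H_n(X)`, `n = p + q`, induced on homology by a simplicial product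
`X ⊗ X ⟶ X`: on classes of cycles it is `[x] · [y] = [x × y]` with the shuffle product `x × y`. -/
def homologyProduct (p q n : ℕ) :
    (chains X).homology p →ₗ[k] (chains X).homology q →ₗ[k] (chains X).homology n :=
  (quotientProduct P p q n).compl₁₂
    (homologyEquiv X p).toLinearMap (homologyEquiv X q).toLinearMap

lemma homologyProduct_class (p q n : ℕ) (x : LinearMap.ker ((chains X).sc p).g.hom)
    (y : LinearMap.ker ((chains X).sc q).g.hom) :
    homologyProduct P p q n (homologyClass X p x) (homologyClass X q y) =
      homologyClass X n (cycleProduct P p q n x y) := by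
  have e (m : ℕ) (z : LinearMap.ker ((chains X).sc m).g.hom) :
      (homologyEquiv X m).toLinearMap (homologyClass X m z) = Submodule.Quotient.mk z := by
    simp [homologyClass]
  rw [homologyProduct, LinearMap.compl₁₂_apply, e, e]
  rfl

end Product

/-! ### Functor homology -/

section FunctorHomology

variable {C : Type} [SmallCategory C]

/-- The category of right `C`-modules has enough projectives. -/
instance enoughProjectives_rightModules : EnoughProjectives (Cᵒᵖ ⥤ ModuleCat.{u} k) where
  presentation G := by
    let M (c : C) : ModuleCat.{u} k := Projective.over (G.obj (op c))
    have hM : ∀ c : C, Projective (Presheaf.freeYoneda c (M c)) := by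
      intro c
      refine ⟨fun {E Z} f e he => ?_⟩
      have : Epi (e.app (op c)) := inferInstance
      refine ⟨Presheaf.freeYonedaHomEquiv.symm
        (Projective.factorThru (Presheaf.freeYonedaHomEquiv f) (e.app (op c))), ?_⟩
      rw [Presheaf.freeYonedaHomEquiv_symm_comp, Projective.factorThru_comp,
        Equiv.symm_apply_apply]
    let π : (∐ fun c : C => Presheaf.freeYoneda c (M c)) ⟶ G :=
      Limits.Sigma.desc fun c => Presheaf.freeYonedaHomEquiv.symm (Projective.π (G.obj (op c)))
    have hπ (c : C) : Epi (π.app (op c)) := by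
      have h : Presheaf.freeYonedaHomEquiv
          (Limits.Sigma.ι (fun c : C => Presheaf.freeYoneda c (M c)) c ≫ π) =
            Projective.π (G.obj (op c)) := by
        simp [π]
      rw [Presheaf.freeYonedaHomEquiv_comp] at h
      have : Epi (Presheaf.freeYonedaHomEquiv
          (Limits.Sigma.ι (fun c : C => Presheaf.freeYoneda c (M c)) c) ≫ π.app (op c)) := by
        rw [h]; infer_instance
      exact epi_of_epi (Presheaf.freeYonedaHomEquiv
          (Limits.Sigma.ι (fun c : C => Presheaf.freeYoneda c (M c)) c)) (π.app (op c))
    have hp : Projective (∐ fun c : C => Presheaf.freeYoneda c (M c)) := by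
      refine ⟨fun {E Z} f e he => ⟨Limits.Sigma.desc fun c =>
        (hM c).factors (Limits.Sigma.ι (fun c : C => Presheaf.freeYoneda c (M c)) c ≫ f) e
          |>.choose, ?_⟩⟩
      refine Limits.Sigma.hom_ext _ _ fun c => ?_
      rw [Limits.Sigma.ι_desc_assoc]
      exact ((hM c).factors (Limits.Sigma.ι (fun c : C => Presheaf.freeYoneda c (M c)) c ≫ f)
        e).choose_spec
    have hepi : Epi π := by
      have (c : Cᵒᵖ) : Epi (π.app c) := hπ c.unop
      exact NatTrans.epi_of_epi_app π
    exact ⟨{ p := _, f := π, projective := hp, epi := hepi }⟩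

open DirectSum

open Classical in
/-- The submodule generated by the elements `G(α)(x) ⊗ y - x ⊗ F(α)(y)`. -/
def tensorRelations (G : Cᵒᵖ ⥤ ModuleCat.{u} k) (F : C ⥤ ModuleCat.{u} k) :
    Submodule k (⨁ c : C, G.obj (op c) ⊗[k] F.obj c) :=
  Submodule.span k {z | ∃ (c d : C) (α : c ⟶ d) (x : G.obj (op d)) (y : F.obj c),
    z = DirectSum.lof k C (fun c => G.obj (op c) ⊗[k] F.obj c) c (G.map α.op x ⊗ₜ[k] y) -
      DirectSum.lof k C (fun c => G.obj (op c) ⊗[k] F.obj c) d (x ⊗ₜ[k] F.map α y)}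

/-- The tensor product `G ⊗_C F` of a right and a left `C`-module. -/
abbrev TensorObj (G : Cᵒᵖ ⥤ ModuleCat.{u} k) (F : C ⥤ ModuleCat.{u} k) : Type u :=
  (⨁ c : C, G.obj (op c) ⊗[k] F.obj c) ⧸ tensorRelations G F

open Classical in
/-- The class `[x ⊗ y]` in `G ⊗_C F`. -/
def tensorMk (G : Cᵒᵖ ⥤ ModuleCat.{u} k) (F : C ⥤ ModuleCat.{u} k) (c : C) :
    G.obj (op c) ⊗[k] F.obj c →ₗ[k] TensorObj G F :=
  (tensorRelations G F).mkQ ∘ₗ DirectSum.lof k C (fun c => G.obj (op c) ⊗[k] F.obj c) c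

lemma tensorMk_relation (G : Cᵒᵖ ⥤ ModuleCat.{u} k) (F : C ⥤ ModuleCat.{u} k) {c d : C}
    (α : c ⟶ d) (x : G.obj (op d)) (y : F.obj c) :
    tensorMk G F c (G.map α.op x ⊗ₜ[k] y) = tensorMk G F d (x ⊗ₜ[k] F.map α y) := by
  rw [← sub_eq_zero]
  exact (Submodule.Quotient.mk_eq_zero _).2 (Submodule.subset_span ⟨c, d, α, x, y, rfl⟩)

lemma tensorObj_hom_ext {G : Cᵒᵖ ⥤ ModuleCat.{u} k} {F : C ⥤ ModuleCat.{u} k} {M : Type*}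
    [AddCommGroup M] [Module k M] {f g : TensorObj G F →ₗ[k] M}
    (h : ∀ c x y, f (tensorMk G F c (x ⊗ₜ[k] y)) = g (tensorMk G F c (x ⊗ₜ[k] y))) : f = g := by
  classical
  refine Submodule.linearMap_qext _ (DirectSum.linearMap_ext _ fun c => ?_)
  exact TensorProduct.ext' (h c)

/-- The universal property of `G ⊗_C F`. -/
def tensorDesc {G : Cᵒᵖ ⥤ ModuleCat.{u} k} {F : C ⥤ ModuleCat.{u} k} {M : Type*}
    [AddCommGroup M] [Module k M] (f : ∀ c : C, G.obj (op c) ⊗[k] F.obj c →ₗ[k] M)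
    (hf : ∀ (c d : C) (α : c ⟶ d) (x : G.obj (op d)) (y : F.obj c),
      f c (G.map α.op x ⊗ₜ[k] y) = f d (x ⊗ₜ[k] F.map α y)) : TensorObj G F →ₗ[k] M := by
  classical
  exact Submodule.liftQ _ (DirectSum.toModule k C M f) (by
    rw [tensorRelations, Submodule.span_le]
    rintro _ ⟨c, d, α, x, y, rfl⟩
    simp [hf _ _ α x y])

lemma tensorDesc_mk {G : Cᵒᵖ ⥤ ModuleCat.{u} k} {F : C ⥤ ModuleCat.{u} k} {M : Type*}
    [AddCommGroup M] [Module k M] (f : ∀ c : C, G.obj (op c) ⊗[k] F.obj c →ₗ[k] M)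
    (hf : ∀ (c d : C) (α : c ⟶ d) (x : G.obj (op d)) (y : F.obj c),
      f c (G.map α.op x ⊗ₜ[k] y) = f d (x ⊗ₜ[k] F.map α y)) (c : C)
    (z : G.obj (op c) ⊗[k] F.obj c) : tensorDesc f hf (tensorMk G F c z) = f c z := by
  classical
  rw [tensorDesc, tensorMk, LinearMap.comp_apply, Submodule.mkQ_apply, Submodule.liftQ_apply,
    DirectSum.toModule_lof]

/-- `Θ ⊗_C F`, given by `[x ⊗ y] ↦ [Θ(x) ⊗ y]`. -/
def tensorMap {G G' : Cᵒᵖ ⥤ ModuleCat.{u} k} (Θ : G ⟶ G') (F : C ⥤ ModuleCat.{u} k) :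
    TensorObj G F →ₗ[k] TensorObj G' F :=
  tensorDesc (fun c => tensorMk G' F c ∘ₗ (Θ.app (op c)).hom.rTensor (F.obj c)) <| by
    intro c d α x y
    have := congrArg (fun f => f.hom x) (Θ.naturality α.op)
    simp only [ModuleCat.hom_comp, LinearMap.comp_apply] at this
    simp only [LinearMap.comp_apply, LinearMap.rTensor_tmul]
    rw [this]
    exact tensorMk_relation G' F α _ y

lemma tensorMap_mk {G G' : Cᵒᵖ ⥤ ModuleCat.{u} k} (Θ : G ⟶ G') (F : C ⥤ ModuleCat.{u} k) (c : C)
    (x : G.obj (op c)) (y : F.obj c) :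
    tensorMap Θ F (tensorMk G F c (x ⊗ₜ[k] y)) = tensorMk G' F c (Θ.app (op c) x ⊗ₜ[k] y) := by
  exact tensorDesc_mk _ _ c _

/-- The functor `- ⊗_C F`. -/
def tensorFunctor (F : C ⥤ ModuleCat.{u} k) : (Cᵒᵖ ⥤ ModuleCat.{u} k) ⥤ ModuleCat.{u} k where
  obj G := ModuleCat.of k (TensorObj G F)
  map Θ := ModuleCat.ofHom (tensorMap Θ F)
  map_id G := by
    ext1
    refine tensorObj_hom_ext fun c x y => ?_
    rw [ModuleCat.hom_ofHom, tensorMap_mk]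
    rfl
  map_comp Θ Ψ := by
    ext1
    refine tensorObj_hom_ext fun c x y => ?_
    rw [ModuleCat.hom_ofHom, ModuleCat.hom_comp, LinearMap.comp_apply, ModuleCat.hom_ofHom,
      ModuleCat.hom_ofHom, tensorMap_mk, tensorMap_mk, tensorMap_mk]
    rfl

instance (F : C ⥤ ModuleCat.{u} k) : (tensorFunctor F).Additive where
  map_add {G G' Θ Ψ} := by
    ext1
    refine tensorObj_hom_ext fun c x y => ?_
    change tensorMap (Θ + Ψ) F _ = tensorMap Θ F _ + tensorMap Ψ F _
    rw [tensorMap_mk, tensorMap_mk, tensorMap_mk, ← map_add, ← TensorProduct.add_tmul]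
    rfl

/-- The `k`-constant right `C`-module `k^*`. -/
abbrev constantModule (k : Type u) [CommRing k] (C : Type) [SmallCategory C] :
    Cᵒᵖ ⥤ ModuleCat.{u} k :=
  (Functor.const Cᵒᵖ).obj (ModuleCat.of k k)

/-- `Tor_n^C(G, F)`, the left derived functors of `- ⊗_C F`. -/
def tor (n : ℕ) (G : Cᵒᵖ ⥤ ModuleCat.{u} k) (F : C ⥤ ModuleCat.{u} k) : ModuleCat.{u} k :=
  ((tensorFunctor F).leftDerived n).obj G

/-- The canonical map `Tor_0^C(G, F) → G ⊗_C F`. -/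
def torZero (G : Cᵒᵖ ⥤ ModuleCat.{u} k) (F : C ⥤ ModuleCat.{u} k) :
    tor 0 G F →ₗ[k] TensorObj G F :=
  ((tensorFunctor F).fromLeftDerivedZero.app G).hom

/-! ### The simplicial module `C_⋆(C, F)` -/

/-- The strings `C_0 → C_1 → ⋯ → C_n` of morphisms: the `n`-simplices of the nerve. -/
abbrev Str (C : Type) [SmallCategory C] (n : SimplexCategoryᵒᵖ) : Type :=
  ComposableArrows C n.unop.len

/-- The simplicial operators of the nerve. -/
abbrev Str.pull {n m : SimplexCategoryᵒᵖ} (α : n ⟶ m) (s : Str C n) : Str C m :=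
  (nerve C).map α s

/-- The composite `C_0 → C_{α(0)}` of morphisms of the string `s`. -/
def Str.initial {n m : SimplexCategoryᵒᵖ} (α : n ⟶ m) (s : Str C n) :
    s.obj 0 ⟶ (Str.pull α s).obj 0 :=
  s.map (homOfLE (Fin.zero_le (α.unop.toOrderHom 0)))

lemma Str.initial_id {n : SimplexCategoryᵒᵖ} (s : Str C n) : Str.initial (𝟙 n) s = 𝟙 _ :=
  s.map_id _

lemma Str.initial_comp {n m l : SimplexCategoryᵒᵖ} (α : n ⟶ m) (β : m ⟶ l) (s : Str C n) :
    Str.initial (α ≫ β) s = Str.initial α s ≫ Str.initial β (Str.pull α s) :=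
  (s.map_comp (homOfLE (Fin.zero_le (α.unop.toOrderHom 0)))
    (homOfLE (α.unop.toOrderHom.monotone (Fin.zero_le (β.unop.toOrderHom 0)))))

/-- The module `C_n(C, F) = ⨁ F(C_0)`, where the sum is over all strings `C_0 → ⋯ → C_n`. -/
abbrev GZ (F : C ⥤ ModuleCat.{u} k) (n : SimplexCategoryᵒᵖ) : Type u :=
  ⨁ s : Str C n, F.obj (s.obj 0)

open Classical in
/-- The generator `(fₙ, …, f₁, x)` of `C_n(C, F)`, where `s` is the string `(fₙ, …, f₁)`. -/
def gzGen (F : C ⥤ ModuleCat.{u} k) {n : SimplexCategoryᵒᵖ} (s : Str C n) :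
    F.obj (s.obj 0) →ₗ[k] GZ F n :=
  DirectSum.lof k (Str C n) (fun s => F.obj (s.obj 0)) s

open Classical in
/-- The linear map out of `C_n(C, F)` with given restrictions to the summands. -/
def gzDesc {F : C ⥤ ModuleCat.{u} k} {n : SimplexCategoryᵒᵖ} {M : Type*} [AddCommGroup M]
    [Module k M] (f : ∀ s : Str C n, F.obj (s.obj 0) →ₗ[k] M) : GZ F n →ₗ[k] M :=
  DirectSum.toModule k _ _ f

lemma gzDesc_gen {F : C ⥤ ModuleCat.{u} k} {n : SimplexCategoryᵒᵖ} {M : Type*} [AddCommGroup M]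
    [Module k M] (f : ∀ s : Str C n, F.obj (s.obj 0) →ₗ[k] M) (s : Str C n) (x : F.obj (s.obj 0)) :
    gzDesc f (gzGen F s x) = f s x := by
  classical
  rw [gzDesc, gzGen, DirectSum.toModule_lof]

lemma gz_hom_ext {F : C ⥤ ModuleCat.{u} k} {n : SimplexCategoryᵒᵖ} {M : Type*} [AddCommGroup M]
    [Module k M] {f g : GZ F n →ₗ[k] M} (h : ∀ s x, f (gzGen F s x) = g (gzGen F s x)) : f = g := by
  classical
  exact DirectSum.linearMap_ext _ fun s => LinearMap.ext (h s)

/-- The simplicial operators `(s, x) ↦ (α^* s, F(C_0 → C_{α(0)})(x))`. -/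
def gzMap (F : C ⥤ ModuleCat.{u} k) {n m : SimplexCategoryᵒᵖ} (α : n ⟶ m) :
    GZ F n →ₗ[k] GZ F m :=
  gzDesc fun s => gzGen F (Str.pull α s) ∘ₗ (F.map (Str.initial α s)).hom

lemma gzMap_gen (F : C ⥤ ModuleCat.{u} k) {n m : SimplexCategoryᵒᵖ} (α : n ⟶ m)
    (s : Str C n) (x : F.obj (s.obj 0)) :
    gzMap F α (gzGen F s x) = gzGen F (Str.pull α s) (F.map (Str.initial α s) x) := by
  rw [gzMap, gzDesc_gen]
  rfl

/-- The simplicial `k`-module `C_⋆(C, F)`. -/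
def gabrielZisman (F : C ⥤ ModuleCat.{u} k) : SimplicialObject (ModuleCat.{u} k) where
  obj n := ModuleCat.of k (GZ F n)
  map α := ModuleCat.ofHom (gzMap F α)
  map_id n := by
    ext1
    refine gz_hom_ext fun s x => ?_
    rw [ModuleCat.hom_ofHom, gzMap_gen]
    have h : (F.map (Str.initial (𝟙 n) s)).hom x = x :=
      (congrArg (fun f : s.obj 0 ⟶ s.obj 0 => (F.map f).hom x) (Str.initial_id s)).trans
        (by rw [F.map_id]; rfl)
    exact congrArg (gzGen F s) h
  map_comp {n m l} α β := by
    ext1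
    refine gz_hom_ext fun s x => ?_
    rw [ModuleCat.hom_ofHom, ModuleCat.hom_comp, LinearMap.comp_apply, ModuleCat.hom_ofHom,
      ModuleCat.hom_ofHom, gzMap_gen, gzMap_gen, gzMap_gen]
    have h : (F.map (Str.initial (α ≫ β) s)).hom x =
        (F.map (Str.initial β (Str.pull α s))).hom ((F.map (Str.initial α s)).hom x) :=
      (congrArg (fun f : s.obj 0 ⟶ (Str.pull β (Str.pull α s)).obj 0 => (F.map f).hom x)
        (Str.initial_comp α β s)).trans (by rw [F.map_comp]; rfl)
    exact congrArg (gzGen F (Str.pull β (Str.pull α s))) h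

/-- `H_n(C, F)`. -/
abbrev functorHomology (n : ℕ) (F : C ⥤ ModuleCat.{u} k) : ModuleCat.{u} k :=
  (chains (gabrielZisman F)).homology n

/-- The `0`-cycle given by an element `x ∈ F(c)`: the generator `x` of the summand of `C_0(C, F)`
indexed by the object `c`. -/
def vertexCycle (F : C ⥤ ModuleCat.{u} k) (c : C) :
    F.obj c →ₗ[k] LinearMap.ker ((chains (gabrielZisman F)).sc 0).g.hom :=
  LinearMap.codRestrict _ (gzGen F (n := op ⦋0⦌) (ComposableArrows.mk₀ c))
    (fun _ => (mem_ker_iff (X := gabrielZisman F) 0 _).2 trivial)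

/-- The class in `H_0(C, F)` of the `0`-cycle given by `x ∈ F(c)`. -/
def vertexClass (F : C ⥤ ModuleCat.{u} k) (c : C) : F.obj c →ₗ[k] functorHomology 0 F :=
  homologyClass (gabrielZisman F) 0 ∘ₗ vertexCycle F c

lemma gzGen_congr (F : C ⥤ ModuleCat.{u} k) {n : SimplexCategoryᵒᵖ} {s s' : Str C n} (h : s = s')
    {x : F.obj (s.obj 0)} {x' : F.obj (s'.obj 0)} (hx : x ≍ x') : gzGen F s x = gzGen F s' x' := by
  subst h
  rw [eq_of_heq hx]

/-- The boundary of `(f, x)` is `(F(f)(x)) - (x)`. -/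
lemma simplicialD_edge (F : C ⥤ ModuleCat.{u} k) (s : Str C (op ⦋1⦌)) (x : F.obj (s.obj 0)) :
    simplicialD (gabrielZisman F) 0 (gzGen F s x) =
      gzGen F (n := op ⦋0⦌) (ComposableArrows.mk₀ (s.obj 1))
        (F.map (s.map (homOfLE (Fin.zero_le 1))) x) -
      gzGen F (n := op ⦋0⦌) (ComposableArrows.mk₀ (s.obj 0)) x := by
  have h0 : (gabrielZisman F).δ 0 (gzGen F s x) =
      gzGen F (n := op ⦋0⦌) (ComposableArrows.mk₀ (s.obj 1))
        (F.map (s.map (homOfLE (Fin.zero_le 1))) x) := by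
    refine (gzMap_gen F (SimplexCategory.δ (0 : Fin 2)).op s x).trans ?_
    exact gzGen_congr F (by apply ComposableArrows.ext₀; rfl) HEq.rfl
  have h1 : (gabrielZisman F).δ 1 (gzGen F s x) =
      gzGen F (n := op ⦋0⦌) (ComposableArrows.mk₀ (s.obj 0)) x := by
    refine (gzMap_gen F (SimplexCategory.δ (1 : Fin 2)).op s x).trans ?_
    refine gzGen_congr F (by apply ComposableArrows.ext₀; rfl) (heq_of_eq ?_)
    have : Str.initial (SimplexCategory.δ (1 : Fin 2)).op s = 𝟙 (s.obj 0) := s.map_id _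
    exact (congrArg (fun f : s.obj 0 ⟶ s.obj 0 => (F.map f).hom x) this).trans
      (by rw [F.map_id]; rfl)
  exact (simplicialD_zero (gabrielZisman F) _).trans (congrArg₂ (fun a b => a - b) h0 h1)

lemma vertexClass_map (F : C ⥤ ModuleCat.{u} k) {c d : C} (α : c ⟶ d) (x : F.obj c) :
    vertexClass F c x = vertexClass F d (F.map α x) := by
  rw [eq_comm, ← sub_eq_zero, vertexClass, vertexClass, LinearMap.comp_apply, LinearMap.comp_apply,
    ← map_sub]
  refine homologyClass_boundary 0 _
    ⟨gzGen F (n := op ⦋1⦌) (ComposableArrows.mk₁ α) x, ?_⟩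
  exact simplicialD_edge F (ComposableArrows.mk₁ α) x

/-- For a functor `ι : B ⥤ C` and a left `C`-module `F`, the map `k^* ⊗_B (F ∘ ι) → H_0(C, F)`
given by `[r ⊗ x] ↦ r [x]`. -/
def tensorToHomology {B : Type} [SmallCategory B] (ι : B ⥤ C) (F : C ⥤ ModuleCat.{u} k) :
    TensorObj (constantModule k B) (ι ⋙ F) →ₗ[k] functorHomology 0 F :=
  tensorDesc (fun b => TensorProduct.lift
    ((LinearMap.lsmul k (functorHomology 0 F)).compl₂ (vertexClass F (ι.obj b)))) <| by
    intro b b' α r x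
    exact congrArg (r • ·) (vertexClass_map F (ι.map α) x)

/-- For a functor `T : C × C ⥤ C` and bilinear maps `F(c) × F(d) → F(T(c, d))`, the product
`(s, x) · (t, y) = (T(s, t), x · y)` on `C_n(C, F)`. -/
def gzMul (F : C ⥤ ModuleCat.{u} k) (T : C × C ⥤ C)
    (μ : ∀ c d : C, F.obj c →ₗ[k] F.obj d →ₗ[k] F.obj (T.obj (c, d))) (n : SimplexCategoryᵒᵖ) :
    GZ F n →ₗ[k] GZ F n →ₗ[k] GZ F n :=
  gzDesc fun s => LinearMap.flip (gzDesc fun t => LinearMap.flip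
    ((μ (s.obj 0) (t.obj 0)).compr₂ (gzGen F (Functor.prod' s t ⋙ T : Str C n))))

lemma gzMul_gen (F : C ⥤ ModuleCat.{u} k) (T : C × C ⥤ C)
    (μ : ∀ c d : C, F.obj c →ₗ[k] F.obj d →ₗ[k] F.obj (T.obj (c, d))) (n : SimplexCategoryᵒᵖ)
    (s t : Str C n) (x : F.obj (s.obj 0)) (y : F.obj (t.obj 0)) :
    gzMul F T μ n (gzGen F s x) (gzGen F t y) =
      gzGen F (Functor.prod' s t ⋙ T : Str C n) (μ (s.obj 0) (t.obj 0) x y) := by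
  rw [gzMul, gzDesc_gen, LinearMap.flip_apply, gzDesc_gen]
  rfl

/-- The simplicial product on `C_⋆(C, F)` given by `gzMul`, for natural bilinear maps. -/
def gzProduct (F : C ⥤ ModuleCat.{u} k) (T : C × C ⥤ C)
    (μ : ∀ c d : C, F.obj c →ₗ[k] F.obj d →ₗ[k] F.obj (T.obj (c, d)))
    (hμ : ∀ {c c' d d' : C} (f : c ⟶ c') (g : d ⟶ d') (x : F.obj c) (y : F.obj d),
      F.map (T.map (Prod.mkHom f g)) (μ c d x y) = μ c' d' (F.map f x) (F.map g y)) :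
    SimplicialProduct (gabrielZisman F) where
  mul n := gzMul F T μ n
  map_mul {n m} f x y := by
    have h : (gzMul F T μ n).compr₂ (gzMap F f) =
        (gzMul F T μ m).compl₁₂ (gzMap F f) (gzMap F f) := by
      refine gz_hom_ext fun s x => gz_hom_ext fun t y => ?_
      rw [LinearMap.compr₂_apply, LinearMap.compl₁₂_apply, gzMap_gen, gzMap_gen, gzMul_gen,
        gzMul_gen]
      refine (gzMap_gen F f _ _).trans ?_
      exact congrArg (gzGen F (Str.pull f (Functor.prod' s t ⋙ T : Str C n)))
        (hμ (Str.initial f s) (Str.initial f t) x y)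
    exact LinearMap.congr_fun (LinearMap.congr_fun h x) y

end FunctorHomology

/-! ### Words in labelled letters

A `C₂`-labelled letter is a pair `(j, b)`; the label `b = false` stands for `1 ∈ C₂` and `b = true`
for the generator `t ∈ C₂`.  A list of labelled letters is a `C₂`-labelled totally ordered multiset. -/

/-- Words in labelled letters. -/
abbrev LWord (ι : Type) : Type := List (ι × Bool)

namespace LWord

variable {ι κ l : Type}

/-- The action of `t ∈ C₂` on a labelled ordered set: reverse the order, multiply labels by `t`. -/
def inv (w : LWord ι) : LWord ι := (w.map fun p => (p.1, !p.2)).reverse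

/-- The action of a label on a word. -/
def act (b : Bool) (w : LWord ι) : LWord ι := if b then inv w else w

/-- Substitution of words for letters. -/
def subst (f : ι → LWord κ) (w : LWord ι) : LWord κ := w.flatMap fun p => act p.2 (f p.1)

lemma inv_inv (w : LWord ι) : inv (inv w) = w := by
  simp [inv, List.map_reverse, Function.comp_def]

lemma act_not (b : Bool) (w : LWord ι) : act (!b) w = inv (act b w) := by
  cases b <;> simp [act, inv_inv]

lemma inv_append (v w : LWord ι) : inv (v ++ w) = inv w ++ inv v := by simp [inv]

lemma subst_cons (f : ι → LWord κ) (p : ι × Bool) (w : LWord ι) :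
    subst f (p :: w) = act p.2 (f p.1) ++ subst f w := by simp [subst]

lemma subst_append (f : ι → LWord κ) (v w : LWord ι) :
    subst f (v ++ w) = subst f v ++ subst f w := by simp [subst]

lemma subst_inv (f : ι → LWord κ) (w : LWord ι) : subst f (inv w) = inv (subst f w) := by
  induction w with
  | nil => rfl
  | cons p w ih =>
    have : inv (p :: w) = inv w ++ [(p.1, !p.2)] := by simp [inv]
    rw [this, subst_append, subst_cons, subst_cons, inv_append, ih, act_not]
    simp [subst]

lemma subst_act (f : ι → LWord κ) (b : Bool) (w : LWord ι) :
    subst f (act b w) = act b (subst f w) := by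
  cases b
  · rfl
  · exact subst_inv f w

lemma subst_subst (f : ι → LWord κ) (g : l → LWord ι) (w : LWord l) :
    subst f (subst g w) = subst (fun j => subst f (g j)) w := by
  induction w with
  | nil => rfl
  | cons p w ih => rw [subst_cons, subst_cons, subst_append, subst_act, ih]

lemma subst_letter (w : LWord ι) : subst (fun j => [(j, false)]) w = w := by
  induction w with
  | nil => rfl
  | cons p w ih =>
    obtain ⟨j, b⟩ := p
    rw [subst_cons, ih]
    cases b <;> simp [act, inv]

lemma letter_subst (f : ι → LWord κ) (j : ι) : subst f [(j, false)] = f j := by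
  simp [subst, act]

/-- Renaming letters. -/
def rename (e : ι → κ) (w : LWord ι) : LWord κ := w.map fun p => (e p.1, p.2)

lemma rename_eq_subst (e : ι → κ) (w : LWord ι) :
    rename e w = subst (fun j => [(e j, false)]) w := by
  induction w with
  | nil => rfl
  | cons p w ih =>
    obtain ⟨j, b⟩ := p
    rw [subst_cons, ← ih]
    cases b <;> simp [act, inv, rename]

/-- The number of occurrences of a letter, with either label. -/
def occ [DecidableEq ι] (j : ι) (w : LWord ι) : ℕ := (w.map Prod.fst).count j

variable [DecidableEq ι] [DecidableEq κ]

lemma occ_append (j : ι) (v w : LWord ι) : occ j (v ++ w) = occ j v + occ j w := by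
  simp [occ]

lemma occ_act (j : ι) (b : Bool) (w : LWord ι) : occ j (act b w) = occ j w := by
  cases b
  · rfl
  · simp [occ, act, inv, List.map_reverse, Function.comp_def]

lemma occ_subst [Fintype ι] (f : ι → LWord κ) (w : LWord ι) (j : κ) :
    occ j (subst f w) = ∑ i, occ i w * occ j (f i) := by
  induction w with
  | nil => simp [occ, subst]
  | cons p w ih =>
    have h (i : ι) : occ i (p :: w) = (if i = p.1 then 1 else 0) + occ i w := by
      rw [← List.singleton_append, occ_append]
      congr 1
      by_cases hi : i = p.1
      · subst hi; simp [occ]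
      · simp [occ, hi, Ne.symm hi]
    rw [subst_cons, occ_append, occ_act, ih]
    simp [h, add_mul, Finset.sum_add_distrib]

end LWord

/-! ### The hyperoctahedral category -/

/-- The objects of `ΔH₊`.  The object with `len = n + 1` is `[n] = {0, …, n}`, and the object with
`len = 0` is the initial object `[-1]`. -/
structure DeltaHPlus : Type where
  len : ℕ

/-- A morphism of (possibly empty) finite sets `{0, …, n-1} → {0, …, m-1}` in `ΔH₊`: a map of sets
together with, on each fibre, a total order and a label in `C₂` for each element.  The fibre over `i`
with its order and labels is the word `fibre i`; every element of the source lies, exactly once, in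
exactly one fibre. -/
@[ext]
structure DeltaHPlus.Hom (n m : DeltaHPlus) : Type where
  fibre : Fin m.len → LWord (Fin n.len)
  occ_sum : ∀ j, ∑ i, LWord.occ j (fibre i) = 1

namespace DeltaHPlus

/-- The identity has fibres `{i¹}`; the fibre over `i` of `f` followed by `g` is obtained from the fibre
of `g` over `i` by replacing `j^z` with the fibre of `f` over `j`, acted on by `z`. -/
instance : SmallCategory DeltaHPlus where
  Hom := Hom
  id n := ⟨fun i => [(i, false)], fun j => by simp [LWord.occ, List.count_singleton]⟩
  comp {n m l} f g := ⟨fun i => LWord.subst f.fibre (g.fibre i), fun j => by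
    simp only [LWord.occ_subst]
    rw [Finset.sum_comm]
    simp only [← Finset.sum_mul, g.occ_sum, one_mul, f.occ_sum]⟩
  id_comp f := Hom.ext (funext fun i => LWord.subst_letter _)
  comp_id f := Hom.ext (funext fun i => LWord.letter_subst _ _)
  assoc f g h := Hom.ext (funext fun i => (LWord.subst_subst _ _ _).symm)

@[ext]
lemma hom_ext {n m : DeltaHPlus} {f g : n ⟶ m} (h : ∀ i, f.fibre i = g.fibre i) : f = g :=
  Hom.ext (funext h)

lemma comp_fibre {n m l : DeltaHPlus} (f : n ⟶ m) (g : m ⟶ l) (i : Fin l.len) :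
    (f ≫ g).fibre i = LWord.subst f.fibre (g.fibre i) := rfl

lemma id_fibre (n : DeltaHPlus) (i : Fin n.len) : (𝟙 n : n ⟶ n).fibre i = [(i, false)] := rfl

/-- The fibres of the disjoint union of two morphisms. -/
def sumFibre {n n' m m' : ℕ} (f : Fin m → LWord (Fin n)) (g : Fin m' → LWord (Fin n')) :
    Fin (m + m') → LWord (Fin (n + n')) :=
  Fin.addCases (fun i => LWord.rename (Fin.castAdd n') (f i))
    (fun i => LWord.rename (Fin.natAdd n) (g i))

lemma occ_castAdd_castAdd {n n' : ℕ} (j : Fin n) (w : LWord (Fin n)) :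
    LWord.occ (Fin.castAdd n' j) (LWord.rename (Fin.castAdd n') w) = LWord.occ j w := by
  have := List.count_map_of_injective (w.map Prod.fst) (Fin.castAdd n')
    (Fin.castAdd_injective n n') j
  simpa [LWord.occ, LWord.rename, Function.comp_def] using this

lemma occ_natAdd_natAdd {n n' : ℕ} (j : Fin n') (w : LWord (Fin n')) :
    LWord.occ (Fin.natAdd n j) (LWord.rename (Fin.natAdd n) w) = LWord.occ j w := by
  have := List.count_map_of_injective (w.map Prod.fst) (Fin.natAdd n)
    (Fin.natAdd_injective n' n) j
  simpa [LWord.occ, LWord.rename, Function.comp_def] using this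

lemma occ_castAdd_natAdd {n n' : ℕ} (j : Fin n) (w : LWord (Fin n')) :
    LWord.occ (Fin.castAdd n' j) (LWord.rename (Fin.natAdd n) w) = 0 := by
  simp only [LWord.occ, LWord.rename, List.map_map, List.count_eq_zero, List.mem_map, not_exists,
    not_and]
  intro p _ h
  have := congrArg Fin.val h
  simp at this
  omega

lemma occ_natAdd_castAdd {n n' : ℕ} (j : Fin n') (w : LWord (Fin n)) :
    LWord.occ (Fin.natAdd n j) (LWord.rename (Fin.castAdd n') w) = 0 := by
  simp only [LWord.occ, LWord.rename, List.map_map, List.count_eq_zero, List.mem_map, not_exists,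
    not_and]
  intro p _ h
  have := congrArg Fin.val h
  simp at this
  omega

/-- The disjoint union `f ⊔ g` of morphisms, the monoidal product of `ΔH₊`. -/
def sumHom {n n' m m' : DeltaHPlus} (f : n ⟶ m) (g : n' ⟶ m') :
    (⟨n.len + n'.len⟩ : DeltaHPlus) ⟶ ⟨m.len + m'.len⟩ where
  fibre := sumFibre f.fibre g.fibre
  occ_sum := by
    refine Fin.addCases (fun j => ?_) (fun j => ?_)
    · change ∑ i : Fin (m.len + m'.len), _ = 1
      simp [Fin.sum_univ_add, sumFibre, occ_castAdd_castAdd, occ_castAdd_natAdd, f.occ_sum]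
    · change ∑ i : Fin (m.len + m'.len), _ = 1
      simp [Fin.sum_univ_add, sumFibre, occ_natAdd_natAdd, occ_natAdd_castAdd, g.occ_sum]

/-- The monoidal product of `ΔH₊`, the disjoint union (`[n] ⊔ [m] = [n + m + 1]`). -/
def sumFunctor : DeltaHPlus × DeltaHPlus ⥤ DeltaHPlus where
  obj p := ⟨p.1.len + p.2.len⟩
  map f := sumHom f.1 f.2
  map_id p := by
    refine hom_ext (Fin.addCases (fun i => ?_) (fun i => ?_)) <;>
      simp [sumHom, sumFibre, id_fibre, LWord.rename]
  map_comp f g := by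
    refine hom_ext (Fin.addCases (fun i => ?_) (fun i => ?_)) <;>
      simp [sumHom, sumFibre, comp_fibre, LWord.rename_eq_subst, LWord.subst_subst,
        LWord.letter_subst]

end DeltaHPlus

/-- The hyperoctahedral category `ΔH`: the full subcategory of `ΔH₊` on the objects `[n]`, `n ≥ 0`. -/
abbrev DeltaH : Type := ObjectProperty.FullSubcategory (fun n : DeltaHPlus => 0 < n.len)

/-- The inclusion `ΔH ⥤ ΔH₊`. -/
abbrev deltaHInclusion : DeltaH ⥤ DeltaHPlus := ObjectProperty.ι _

/-! ### The hyperoctahedral bar construction -/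

section Bar

open PiTensorProduct

variable (k) [Star k] [TrivialStar k] (A : Type u) [Ring A] [Algebra k A] [StarRing A]
  [StarModule k A]

variable {A} in
/-- `a^z`, which is `a` for `z = 1` and `star a` for `z = t`. -/
def starPow (a : A) (z : Bool) : A := if z then star a else a

variable {A} in
/-- The ordered product `∏ a_i^{z_i}` over a labelled ordered set. -/
def wordProd {ι : Type} (a : ι → A) (w : LWord ι) : A :=
  (w.map fun p => starPow (a p.1) p.2).prod

variable {A} in
lemma wordProd_append {ι : Type} (a : ι → A) (v w : LWord ι) :
    wordProd a (v ++ w) = wordProd a v * wordProd a w := by simp [wordProd]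

variable {A} in
lemma wordProd_cons {ι : Type} (a : ι → A) (p : ι × Bool) (w : LWord ι) :
    wordProd a (p :: w) = starPow (a p.1) p.2 * wordProd a w := by simp [wordProd]

variable {A} in
lemma starPow_not (a : A) (z : Bool) : starPow a (!z) = star (starPow a z) := by
  cases z <;> simp [starPow]

variable {A} in
lemma wordProd_inv {ι : Type} (a : ι → A) (w : LWord ι) :
    wordProd a (LWord.inv w) = star (wordProd a w) := by
  induction w with
  | nil => simp [LWord.inv, wordProd]
  | cons p w ih =>
    have : LWord.inv (p :: w) = LWord.inv w ++ [(p.1, !p.2)] := by simp [LWord.inv]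
    rw [this, wordProd_append, wordProd_cons, wordProd_cons, ih, star_mul, starPow_not]
    simp [wordProd]

variable {A} in
lemma wordProd_act {ι : Type} (a : ι → A) (z : Bool) (w : LWord ι) :
    wordProd a (LWord.act z w) = starPow (wordProd a w) z := by
  cases z
  · rfl
  · exact wordProd_inv a w

variable {A} in
lemma wordProd_subst {ι κ : Type} (a : κ → A) (f : ι → LWord κ) (w : LWord ι) :
    wordProd a (LWord.subst f w) = wordProd (fun j => wordProd a (f j)) w := by
  induction w with
  | nil => rfl
  | cons p w ih => rw [LWord.subst_cons, wordProd_append, wordProd_act, ih, wordProd_cons]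

variable {A} in
lemma wordProd_rename {ι κ : Type} (a : κ → A) (e : ι → κ) (w : LWord ι) :
    wordProd a (LWord.rename e w) = wordProd (fun j => a (e j)) w := by
  simp [wordProd, LWord.rename, Function.comp_def]

section Multilinear

variable {A} {ι : Type} [DecidableEq ι] (a : ι → A) (j : ι)

lemma occ_cons (p : ι × Bool) (w : LWord ι) :
    LWord.occ j (p :: w) = LWord.occ j w + if p.1 = j then 1 else 0 := by
  simp [LWord.occ, List.count_cons]

lemma wordProd_update_of_occ_zero (x : A) (w : LWord ι) (h : LWord.occ j w = 0) :
    wordProd (Function.update a j x) w = wordProd a w := by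
  induction w with
  | nil => rfl
  | cons p w ih =>
    rw [occ_cons] at h
    have h1 : LWord.occ j w = 0 := by omega
    have h2 : p.1 ≠ j := by
      rintro h2
      simp [h2] at h
    rw [wordProd_cons, wordProd_cons, ih h1, Function.update_of_ne h2]

lemma wordProd_update_add (x y : A) (w : LWord ι) (h : LWord.occ j w = 1) :
    wordProd (Function.update a j (x + y)) w =
      wordProd (Function.update a j x) w + wordProd (Function.update a j y) w := by
  induction w with
  | nil => simp [LWord.occ] at h
  | cons p w ih =>
    rw [occ_cons] at h
    by_cases h2 : p.1 = j
    · have h1 : LWord.occ j w = 0 := by simpa [h2] using h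
      have e : starPow (x + y) p.2 = starPow x p.2 + starPow y p.2 := by
        cases p.2 <;> simp [starPow]
      simp only [wordProd_cons, wordProd_update_of_occ_zero a j _ w h1, h2, Function.update_self, e,
        add_mul]
    · have h1 : LWord.occ j w = 1 := by simpa [h2] using h
      simp only [wordProd_cons, ih h1, Function.update_of_ne h2, mul_add]

lemma wordProd_update_smul (c : k) (x : A) (w : LWord ι) (h : LWord.occ j w = 1) :
    wordProd (Function.update a j (c • x)) w = c • wordProd (Function.update a j x) w := by
  induction w with
  | nil => simp [LWord.occ] at h
  | cons p w ih =>
    rw [occ_cons] at h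
    by_cases h2 : p.1 = j
    · have h1 : LWord.occ j w = 0 := by simpa [h2] using h
      have e : starPow (c • x) p.2 = c • starPow x p.2 := by
        cases p.2 <;> simp [starPow]
      simp only [wordProd_cons, wordProd_update_of_occ_zero a j _ w h1, h2, Function.update_self, e,
        smul_mul_assoc]
    · have h1 : LWord.occ j w = 1 := by simpa [h2] using h
      simp only [wordProd_cons, ih h1, Function.update_of_ne h2, mul_smul_comm]

end Multilinear

variable {A} in
/-- Changing the entry `j` changes exactly one of the products over the fibres. -/
lemma wordProd_update_fibre {n m : DeltaHPlus} (f : n ⟶ m) (j : Fin n.len) :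
    ∃ i, LWord.occ j (f.fibre i) = 1 ∧ ∀ (a : Fin n.len → A) (x : A),
      (fun i' => wordProd (Function.update a j x) (f.fibre i')) =
        Function.update (fun i' => wordProd a (f.fibre i')) i
          (wordProd (Function.update a j x) (f.fibre i)) := by
  have hs := f.occ_sum j
  obtain ⟨i, hi⟩ : ∃ i, LWord.occ j (f.fibre i) ≠ 0 := by
    by_contra! h
    simp [h] at hs
  rw [← Finset.add_sum_erase _ _ (Finset.mem_univ i)] at hs
  have h1 : LWord.occ j (f.fibre i) = 1 := by omega
  refine ⟨i, h1, fun a x => ?_⟩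
  funext i'
  by_cases h : i' = i
  · subst h; simp
  · rw [Function.update_of_ne h]
    have h0 : ∑ i ∈ Finset.univ.erase i, LWord.occ j (f.fibre i) = 0 := by omega
    exact wordProd_update_of_occ_zero a j x _
      (Finset.sum_eq_zero_iff.1 h0 i' (Finset.mem_erase.2 ⟨h, Finset.mem_univ _⟩))

/-- The map `A^{⊗ n} → A^{⊗ m}`, `a_0 ⊗ a_1 ⊗ ⋯ ↦ (∏_{i ∈ f⁻¹(0)} a_i^{z_i}) ⊗ ⋯`, with the products
ordered as the fibres of `f`. -/
def barMap {n m : DeltaHPlus} (f : n ⟶ m) : (⨂[k]^n.len A) →ₗ[k] ⨂[k]^m.len A :=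
  PiTensorProduct.lift
    { toFun := fun a => PiTensorProduct.tprod k fun i => wordProd a (f.fibre i)
      map_update_add' := by
        intro inst a j x y
        obtain rfl : inst = instDecidableEqFin n.len := Subsingleton.elim _ _
        obtain ⟨i, hi, h⟩ := wordProd_update_fibre (A := A) f j
        rw [h, h, h, wordProd_update_add a j x y _ hi, MultilinearMap.map_update_add]
      map_update_smul' := by
        intro inst a j c x
        obtain rfl : inst = instDecidableEqFin n.len := Subsingleton.elim _ _
        obtain ⟨i, hi, h⟩ := wordProd_update_fibre (A := A) f j
        rw [h, h, wordProd_update_smul k a j c x _ hi, MultilinearMap.map_update_smul] }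

lemma barMap_tprod {n m : DeltaHPlus} (f : n ⟶ m) (a : Fin n.len → A) :
    barMap k A f (PiTensorProduct.tprod k a) =
      PiTensorProduct.tprod k fun i => wordProd a (f.fibre i) := by
  rw [barMap, PiTensorProduct.lift.tprod]
  rfl

/-- The extended hyperoctahedral bar construction `H_{A+} : ΔH₊ ⥤ Mod_k`, with
`H_{A+}([n]) = A^{⊗ (n+1)}` and `H_{A+}([-1]) = A^{⊗ 0} = k`. -/
def barPlus : DeltaHPlus ⥤ ModuleCat.{u} k where
  obj n := ModuleCat.of k (⨂[k]^n.len A)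
  map f := ModuleCat.ofHom (barMap k A f)
  map_id n := by
    ext1
    refine PiTensorProduct.ext (MultilinearMap.ext fun a => ?_)
    refine (barMap_tprod k A _ a).trans ?_
    simp [DeltaHPlus.id_fibre, wordProd, starPow]
  map_comp f g := by
    ext1
    refine PiTensorProduct.ext (MultilinearMap.ext fun a => ?_)
    refine (barMap_tprod k A _ a).trans ?_
    refine Eq.trans ?_ (congrArg (barMap k A g) (barMap_tprod k A f a)).symm
    refine Eq.trans ?_ (barMap_tprod k A g _).symm
    simp only [DeltaHPlus.comp_fibre, wordProd_subst]

/-- The hyperoctahedral bar construction `H_A : ΔH ⥤ Mod_k`. -/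
abbrev bar : DeltaH ⥤ ModuleCat.{u} k := deltaHInclusion ⋙ barPlus k A

/-- Hyperoctahedral homology `HO_n(A) = Tor_n^{ΔH}(k^*, H_A)`. -/
def HO (n : ℕ) : ModuleCat.{u} k := tor n (constantModule k DeltaH) (bar k A)

/-- The homology `H_n(ΔH₊, H_{A+})` of the simplicial `k`-module `C_⋆(ΔH₊, H_{A+})`. -/
abbrev HOPlus (n : ℕ) : ModuleCat.{u} k := functorHomology n (barPlus k A)

/-- The canonical comparison in degree zero,
`Tor_0^{ΔH}(k^*, H_A) → k^* ⊗_{ΔH} H_A → H_0(ΔH₊, H_{A+})`. -/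
def comparisonZero : HO k A 0 →ₗ[k] HOPlus k A 0 :=
  tensorToHomology deltaHInclusion (barPlus k A) ∘ₗ torZero (constantModule k DeltaH) (bar k A)

/-- Juxtaposition of tensors `A^{⊗ n} × A^{⊗ m} → A^{⊗ (n+m)}`. -/
def juxtapose (n m : DeltaHPlus) : (barPlus k A).obj n →ₗ[k] (barPlus k A).obj m →ₗ[k]
    (barPlus k A).obj (DeltaHPlus.sumFunctor.obj (n, m)) :=
  (TensorProduct.mk k (⨂[k]^n.len A) (⨂[k]^m.len A)).compr₂ TensorPower.mulEquiv.toLinearMap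

lemma juxtapose_tprod (n m : DeltaHPlus) (a : Fin n.len → A) (b : Fin m.len → A) :
    juxtapose k A n m (PiTensorProduct.tprod k a) (PiTensorProduct.tprod k b) =
      PiTensorProduct.tprod k (Fin.append a b) :=
  TensorPower.tprod_mul_tprod k a b

lemma juxtapose_natural {n n' m m' : DeltaHPlus} (f : n ⟶ n') (g : m ⟶ m')
    (x : (barPlus k A).obj n) (y : (barPlus k A).obj m) :
    (barPlus k A).map (DeltaHPlus.sumFunctor.map (Prod.mkHom f g)) (juxtapose k A n m x y) =
      juxtapose k A n' m' ((barPlus k A).map f x) ((barPlus k A).map g y) := by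
  have h : (juxtapose k A n m).compr₂
        (barMap k A (DeltaHPlus.sumFunctor.map (Prod.mkHom f g))) =
      (juxtapose k A n' m').compl₁₂ (barMap k A f) (barMap k A g) := by
    refine PiTensorProduct.ext (MultilinearMap.ext fun a => ?_)
    refine PiTensorProduct.ext (MultilinearMap.ext fun b => ?_)
    refine (congrArg (barMap k A _) (juxtapose_tprod k A n m a b)).trans ?_
    refine (barMap_tprod k A _ _).trans ?_
    refine Eq.trans ?_ (congrArg₂ (fun x y => juxtapose k A n' m' x y) (barMap_tprod k A f a)
      (barMap_tprod k A g b)).symm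
    refine Eq.trans ?_ (juxtapose_tprod k A n' m' _ _).symm
    congr 1
    refine funext (Fin.addCases (fun i => ?_) (fun i => ?_))
    · simp [DeltaHPlus.sumFunctor, DeltaHPlus.sumHom, DeltaHPlus.sumFibre, wordProd_rename]
    · simp [DeltaHPlus.sumFunctor, DeltaHPlus.sumHom, DeltaHPlus.sumFibre, wordProd_rename]
  exact LinearMap.congr_fun (LinearMap.congr_fun h x) y

/-- The product `C_⋆ ⊗ C_⋆ ⟶ C_⋆` on `C_⋆ = C_⋆(ΔH₊, H_{A+})`:
`(fₙ, …, f₁, x) · (gₙ, …, g₁, y) = (fₙ ⊔ gₙ, …, f₁ ⊔ g₁, x ⊗ y)`.  This is the arity-two structure map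
of the action of the Barratt–Eccles operad at the vertex `id ∈ Σ₂`. -/
def barProduct : SimplicialProduct (gabrielZisman (barPlus k A)) :=
  gzProduct (barPlus k A) DeltaHPlus.sumFunctor (juxtapose k A) (juxtapose_natural k A)

/-- The Pontryagin product `H_p × H_q → H_{p+q}` on `H_⋆(ΔH₊, H_{A+})`. -/
def pontryagin (p q : ℕ) : HOPlus k A p →ₗ[k] HOPlus k A q →ₗ[k] HOPlus k A (p + q) :=
  homologyProduct (barProduct k A) p q (p + q)

/-- The two-sided ideal of `A` generated by the elements `a₀a₁a₂ - a₂ā₁a₀`. -/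
def relationIdeal : TwoSidedIdeal A :=
  TwoSidedIdeal.span {z | ∃ a₀ a₁ a₂ : A, z = a₀ * a₁ * a₂ - a₂ * star a₁ * a₀}

/-- The `k`-algebra `A / (a₀a₁a₂ - a₂ā₁a₀)`. -/
abbrev RelationQuotient : Type u := (relationIdeal A).ringCon.Quotient

end Bar

end

end HyperoctahedralHomology

open HyperoctahedralHomology

/-! Both `k^* ⊗_{ΔH} H_A` and `H_0(ΔH₊, H_{A+})` are colimits: they are generated by the tensors at
the various objects, and a tensor is identified with its image under every morphism. Every object
has morphisms to `[0]`, one for each total order and labelling of its elements. Hence each class is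
represented by a single letter `a ∈ A` (`letterClass_surjective`, `homologyZero_letter`), and
different morphisms to `[0]` from the same object give relations between letters.

Multiplying five letters in increasing order, or with the second and fourth exchanged and the third
conjugated, shows that all two-sided multiples of `a₀a₁a₂ - a₂ā₁a₀` die (`letterClass_relation`,
`letterClass_relationIdeal`). There are no further relations. In the quotient algebra, `a₁ = 1`
gives commutativity and `a₀ = a₂ = 1` makes the involution trivial, so the product of all factors of
a tensor ignores order and labels and is invariant under every morphism (`multiplyAll_map`). This
defines a map from `H_0(ΔH₊, H_{A+})` to the quotient.

The composite `A → k^* ⊗_{ΔH} H_A → H_0(ΔH₊, H_{A+}) → A/I` is the canonical projection. Since `A`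
surjects onto both middle terms and the first arrow already kills `I`, the last two arrows are
bijective. The added object `[-1]` contributes nothing new, because its generator is identified with
the letter `1`. The passage from `Tor_0` to the tensor product is right exactness
(`torZero_bijective`).

For the product, only the trivial shuffle occurs in bidegree `(0,0)`. Two letters `a`, `b` therefore
multiply to the tensor `a ⊗ b` at `[1]`, which a morphism to `[0]` sends to `ab`
(`pontryagin_letter`). -/

open Opposite

namespace HyperoctahedralHomology

noncomputable section

/-! ### Right exactness of the tensor product of functors -/

section RightExact

variable {k : Type u} [CommRing k] {C : Type} [SmallCategory C]

/-- The right `C`-module `c ↦ Hom_k(F(c), M)`. -/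
def homModule (F : C ⥤ ModuleCat.{u} k) (M : ModuleCat.{u} k) : Cᵒᵖ ⥤ ModuleCat.{u} k where
  obj c := ModuleCat.of k (F.obj c.unop →ₗ[k] M)
  map α := ModuleCat.ofHom (LinearMap.lcomp k M (F.map α.unop).hom)
  map_id c := by
    ext f x
    change f ((F.map (𝟙 c.unop)).hom x) = f x
    rw [F.map_id]
    rfl
  map_comp α β := by
    ext f x
    change f ((F.map (β.unop ≫ α.unop)).hom x) = f ((F.map α.unop).hom ((F.map β.unop).hom x))
    rw [F.map_comp]
    rfl

/-- The linear map `G ⊗_C F → M`, `[x ⊗ y] ↦ Θ(x)(y)`. -/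
def tensorUncurry {F : C ⥤ ModuleCat.{u} k} {G : Cᵒᵖ ⥤ ModuleCat.{u} k} {M : ModuleCat.{u} k}
    (Θ : G ⟶ homModule F M) : TensorObj G F →ₗ[k] M :=
  tensorDesc (fun c => TensorProduct.lift (Θ.app (op c)).hom) (by
    intro c d α x y
    exact LinearMap.congr_fun (congrArg (fun f => f.hom x) (Θ.naturality α.op)) y)

lemma tensorUncurry_mk {F : C ⥤ ModuleCat.{u} k} {G : Cᵒᵖ ⥤ ModuleCat.{u} k}
    {M : ModuleCat.{u} k} (Θ : G ⟶ homModule F M) (c : C) (x : G.obj (op c)) (y : F.obj c) :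
    tensorUncurry Θ (tensorMk G F c (x ⊗ₜ[k] y)) = (show F.obj c →ₗ[k] M from (Θ.app (op c)).hom x) y :=
  tensorDesc_mk _ _ c _

/-- The tensor-hom adjunction for functors. -/
def tensorHomEquiv (F : C ⥤ ModuleCat.{u} k) (G : Cᵒᵖ ⥤ ModuleCat.{u} k) (M : ModuleCat.{u} k) :
    ((tensorFunctor F).obj G ⟶ M) ≃ (G ⟶ homModule F M) where
  toFun f :=
    { app c := ModuleCat.ofHom (TensorProduct.curry (f.hom ∘ₗ tensorMk G F c.unop))
      naturality c d α := by
        ext x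
        refine LinearMap.ext fun y => ?_
        -- Naturality of the curried map is exactly the relation `G(α)(x) ⊗ y = x ⊗ F(α)(y)`
        -- defining the tensor product.
        exact congrArg f.hom (tensorMk_relation G F α.unop x y) }
  invFun Θ := ModuleCat.ofHom (tensorUncurry Θ)
  left_inv f := by
    ext1
    exact tensorObj_hom_ext fun c x y => tensorUncurry_mk _ c x y
  right_inv Θ := by
    ext c x
    exact LinearMap.ext fun y => tensorUncurry_mk Θ c.unop x y

/-- The functor `- ⊗_C F` is a left adjoint. -/
def tensorAdjunction (F : C ⥤ ModuleCat.{u} k) :=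
  Adjunction.adjunctionOfEquivRight (F := tensorFunctor F) (tensorHomEquiv F) (by
    intro G G' M Θ f
    ext c x
    refine LinearMap.ext fun y => ?_
    exact congrArg f.hom (tensorMap_mk Θ F c.unop x y))

instance (F : C ⥤ ModuleCat.{u} k) : (tensorFunctor F).IsLeftAdjoint :=
  (tensorAdjunction F).isLeftAdjoint

/-- A left adjoint is right exact, and a right exact additive functor agrees with its zeroth left
derived functor. -/
lemma torZero_bijective (G : Cᵒᵖ ⥤ ModuleCat.{u} k) (F : C ⥤ ModuleCat.{u} k) :
    Function.Bijective (torZero G F) :=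
  ConcreteCategory.bijective_of_isIso ((tensorFunctor F).fromLeftDerivedZero.app G)

/-! ### Degree zero -/

/-- The class `[1 ⊗ x]` in `k^* ⊗_C F`. -/
def constantMk (F : C ⥤ ModuleCat.{u} k) (c : C) : F.obj c →ₗ[k] TensorObj (constantModule k C) F :=
  tensorMk (constantModule k C) F c ∘ₗ TensorProduct.mk k k (F.obj c) 1

lemma constantMk_map (F : C ⥤ ModuleCat.{u} k) {c d : C} (α : c ⟶ d) (x : F.obj c) :
    constantMk F c x = constantMk F d (F.map α x) :=
  tensorMk_relation (constantModule k C) F α (1 : k) x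

/-- Phrased for a submodule `p`, so that it suffices to show that the projection modulo `p` vanishes
on generators. -/
lemma constantTensor_induction (F : C ⥤ ModuleCat.{u} k)
    (p : Submodule k (TensorObj (constantModule k C) F)) (h : ∀ c x, constantMk F c x ∈ p)
    (t : TensorObj (constantModule k C) F) : t ∈ p := by
  have h0 : p.mkQ = 0 := by
    refine tensorObj_hom_ext fun c (r : k) x => ?_
    -- The scalar moves across the tensor sign, so generators with first factor `1` are enough.
    have e : tensorMk (constantModule k C) F c (r ⊗ₜ[k] x) = constantMk F c (r • x) := by
      have : r ⊗ₜ[k] x = (1 : k) ⊗ₜ[k] (r • x) := by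
        rw [← TensorProduct.smul_tmul, smul_eq_mul, mul_one]
      exact congrArg _ this
    rw [e, LinearMap.zero_apply]
    exact (Submodule.Quotient.mk_eq_zero p).2 (h c _)
  rw [← Submodule.Quotient.mk_eq_zero p]
  exact LinearMap.congr_fun h0 t

lemma tensorToHomology_constantMk {B : Type} [SmallCategory B] (ι : B ⥤ C)
    (F : C ⥤ ModuleCat.{u} k) (b : B) (x : F.obj (ι.obj b)) :
    tensorToHomology ι F (constantMk (ι ⋙ F) b x) = vertexClass F (ι.obj b) x := by
  refine (tensorDesc_mk _ _ b _).trans ?_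
  exact one_smul k (vertexClass F (ι.obj b) x)

/-! ### Generators of `H_0(C, F)` and linear maps out of it. -/

lemma homologyClass_surjective (X : SimplicialObject (ModuleCat.{u} k)) (n : ℕ) :
    Function.Surjective (homologyClass X n) :=
  (homologyEquiv X n).symm.surjective.comp (Submodule.mkQ_surjective _)

/-- A string of length zero carries only its object, but as a functor it is not syntactically of the
form `mk₀`; this equality transports generators between the two forms. -/
lemma mk₀_obj_zero (s : Str C (op (SimplexCategory.mk 0))) :
    ComposableArrows.mk₀ (s.obj 0) = s :=
  ComposableArrows.ext₀ rfl

/-- Every `0`-chain is a cycle, so `H_0` is a quotient of the whole of `C_0(C, F)`, a direct sum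
over the objects. -/
lemma homologyZero_induction (F : C ⥤ ModuleCat.{u} k) (p : Submodule k (functorHomology 0 F))
    (h : ∀ c x, vertexClass F c x ∈ p) (t : functorHomology 0 F) : t ∈ p := by
  obtain ⟨z, rfl⟩ := homologyClass_surjective _ 0 t
  have hcyc : ∀ x : GZ F (op (SimplexCategory.mk 0)),
      x ∈ LinearMap.ker ((chains (gabrielZisman F)).sc 0).g.hom :=
    fun x => (mem_ker_iff (X := gabrielZisman F) 0 x).2 trivial
  let toCycle : GZ F (op (SimplexCategory.mk 0)) →ₗ[k]
      LinearMap.ker ((chains (gabrielZisman F)).sc 0).g.hom :=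
    LinearMap.codRestrict _ LinearMap.id hcyc
  have h0 : p.mkQ ∘ₗ homologyClass (gabrielZisman F) 0 ∘ₗ toCycle = 0 := by
    refine gz_hom_ext fun s x => ?_
    refine (Submodule.Quotient.mk_eq_zero p).2 ?_
    -- The summand is indexed by the string `s`, whereas `vertexClass` uses the string rebuilt from
    -- its object.
    convert h (s.obj 0) x using 1
    refine congrArg (homologyClass (gabrielZisman F) 0) (Subtype.ext ?_)
    exact gzGen_congr F (mk₀_obj_zero s).symm HEq.rfl
  rw [← Submodule.Quotient.mk_eq_zero p]
  exact LinearMap.congr_fun h0 z.1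

/-- The map `C_0(C, F) → M` given by a family of maps `F(c) → M`. -/
def verticesDesc (F : C ⥤ ModuleCat.{u} k) {M : Type u} [AddCommGroup M] [Module k M]
    (f : ∀ c, F.obj c →ₗ[k] M) :
    (gabrielZisman F).obj (op (SimplexCategory.mk 0)) →ₗ[k] M :=
  gzDesc (F := F) (n := op (SimplexCategory.mk 0)) fun s => f (s.obj 0)

lemma verticesDesc_gen (F : C ⥤ ModuleCat.{u} k) {M : Type u} [AddCommGroup M] [Module k M]
    (f : ∀ c, F.obj c →ₗ[k] M) (c : C) (x : F.obj c) :
    verticesDesc F f (gzGen F (n := op (SimplexCategory.mk 0)) (ComposableArrows.mk₀ c) x) =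
      f c x :=
  gzDesc_gen (F := F) (n := op (SimplexCategory.mk 0)) (fun s => f (s.obj 0))
    (ComposableArrows.mk₀ c) x

/-- The boundary of an edge `(α, x)` is `F(α)(x) - x`, which the cocone condition kills. This is
what lets a cocone descend to `H_0`. -/
lemma verticesDesc_boundary (F : C ⥤ ModuleCat.{u} k) {M : Type u} [AddCommGroup M] [Module k M]
    (f : ∀ c, F.obj c →ₗ[k] M) (hf : ∀ {c d : C} (α : c ⟶ d) x, f d (F.map α x) = f c x)
    (z : (gabrielZisman F).obj (op (SimplexCategory.mk 1))) :
    verticesDesc F f (simplicialD (gabrielZisman F) 0 z) = 0 := by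
  have h0 : verticesDesc F f ∘ₗ simplicialD (gabrielZisman F) 0 = 0 := by
    refine gz_hom_ext (F := F) (n := op (SimplexCategory.mk 1)) fun s x => ?_
    refine (congrArg (verticesDesc F f) (simplicialD_edge F s x)).trans ?_
    refine (map_sub (verticesDesc F f) _ _).trans (sub_eq_zero.2 ?_)
    exact (verticesDesc_gen F f _ _).trans ((hf _ x).trans (verticesDesc_gen F f _ x).symm)
  exact LinearMap.congr_fun h0 z

/-- The linear map out of `H_0(C, F)` given by a cocone under `F`. -/
def homologyZeroDesc (F : C ⥤ ModuleCat.{u} k) {M : Type u} [AddCommGroup M] [Module k M]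
    (f : ∀ c, F.obj c →ₗ[k] M) (hf : ∀ {c d : C} (α : c ⟶ d) x, f d (F.map α x) = f c x) :
    functorHomology 0 F →ₗ[k] M :=
  Submodule.liftQ _ (verticesDesc F f ∘ₗ
    (LinearMap.ker ((chains (gabrielZisman F)).sc 0).g.hom).subtype) (by
      intro x hx
      obtain ⟨z, hz⟩ := (mem_range_iff (X := gabrielZisman F) 0 x).1 hx
      refine LinearMap.mem_ker.2 ?_
      exact (congrArg (verticesDesc F f) hz.symm).trans (verticesDesc_boundary F f hf z)) ∘ₗ
  (homologyEquiv (gabrielZisman F) 0).toLinearMap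

lemma homologyZeroDesc_vertexClass (F : C ⥤ ModuleCat.{u} k) {M : Type u} [AddCommGroup M]
    [Module k M] (f : ∀ c, F.obj c →ₗ[k] M)
    (hf : ∀ {c d : C} (α : c ⟶ d) x, f d (F.map α x) = f c x) (c : C) (x : F.obj c) :
    homologyZeroDesc F f hf (vertexClass F c x) = f c x := by
  have e : (homologyEquiv (gabrielZisman F) 0).toLinearMap (vertexClass F c x) =
      Submodule.Quotient.mk (vertexCycle F c x) := by
    simp [vertexClass, homologyClass]
  rw [homologyZeroDesc, LinearMap.comp_apply, e]
  exact verticesDesc_gen F f c x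

/-- The chain-level input for the Pontryagin product in degree zero. -/
lemma gzMul_vertex (F : C ⥤ ModuleCat.{u} k) (T : C × C ⥤ C)
    (μ : ∀ c d : C, F.obj c →ₗ[k] F.obj d →ₗ[k] F.obj (T.obj (c, d))) (c d : C)
    (x : F.obj c) (y : F.obj d) :
    gzMul F T μ (op (SimplexCategory.mk 0)) (gzGen F (ComposableArrows.mk₀ c) x)
        (gzGen F (ComposableArrows.mk₀ d) y) =
      gzGen F (n := op (SimplexCategory.mk 0)) (ComposableArrows.mk₀ (T.obj (c, d))) (μ c d x y) := by
  refine (gzMul_gen F T μ (op (SimplexCategory.mk 0)) (ComposableArrows.mk₀ c)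
    (ComposableArrows.mk₀ d) x y).trans ?_
  exact gzGen_congr F (mk₀_obj_zero (Functor.prod' (ComposableArrows.mk₀ c)
    (ComposableArrows.mk₀ d) ⋙ T)).symm HEq.rfl

end RightExact

/-! ### The degree zero homology of the bar construction -/

section BarZero

variable (k : Type u) [CommRing k] [Star k] [TrivialStar k]
  (A : Type u) [Ring A] [Algebra k A] [StarRing A] [StarModule k A]

/-- The morphism `[n] ⟶ [0]` of `ΔH₊` with a given total order and labels. -/
def wordHom {n : ℕ} (w : LWord (Fin n)) (h : ∀ j, LWord.occ j w = 1) :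
    (⟨n⟩ : DeltaHPlus) ⟶ ⟨1⟩ where
  fibre _ := w
  occ_sum j := (Fin.sum_univ_one (fun _ => LWord.occ j w)).trans (h j)

variable {A}

/-- The element `a` of `H_{A+}([0]) = A`. -/
def letter (a : A) : (barPlus k A).obj ⟨1⟩ := PiTensorProduct.tprod k fun _ : Fin 1 => a

lemma map_wordHom {n : ℕ} (w : LWord (Fin n)) (h : ∀ j, LWord.occ j w = 1) (a : Fin n → A) :
    (barPlus k A).map (wordHom w h) (PiTensorProduct.tprod k a) = letter k (wordProd a w) :=
  barMap_tprod k A (wordHom w h) a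

variable (A) in
/-- The map `A → k^* ⊗_{ΔH} H_A`, `a ↦ [1 ⊗ a]`. -/
def letterClass : A →ₗ[k] TensorObj (constantModule k DeltaH) (bar k A) :=
  constantMk (bar k A) ⟨⟨1⟩, Nat.one_pos⟩ ∘ₗ
    (PiTensorProduct.subsingletonEquiv (R := k) (s := fun _ : Fin 1 => A) 0).symm.toLinearMap

lemma letterClass_apply (a : A) :
    letterClass k A a = constantMk (bar k A) ⟨⟨1⟩, Nat.one_pos⟩ (letter k a) := by
  refine congrArg (constantMk (bar k A) ⟨⟨1⟩, Nat.one_pos⟩) ?_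
  refine (LinearEquiv.symm_apply_eq _).2 ?_
  exact (PiTensorProduct.subsingletonEquiv_apply_tprod (R := k) (0 : Fin 1) fun _ => a).symm

/-! ### Reduction to single letters, and the relations between them. -/

/-- The word `w` is a free choice of order and labels on `[n-1]`, that is, of a morphism to `[0]`.
Applying this to two words for one tensor is the source of all relations. Positivity of `n` is
needed because `[-1]` is not an object of `ΔH`. -/
lemma constantMk_tprod {n : ℕ} (hn : 0 < n) (a : Fin n → A) (w : LWord (Fin n))
    (h : ∀ j, LWord.occ j w = 1) :
    constantMk (bar k A) ⟨⟨n⟩, hn⟩ (PiTensorProduct.tprod k a) = letterClass k A (wordProd a w) := by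
  rw [letterClass_apply, ← map_wordHom k w h]
  exact constantMk_map (bar k A) (c := ⟨⟨n⟩, hn⟩) (d := ⟨⟨1⟩, Nat.one_pos⟩)
    (ObjectProperty.homMk (wordHom w h)) (PiTensorProduct.tprod k a)

/-- The word containing every letter once, in increasing order and with trivial labels. -/
def fullWord (n : ℕ) : LWord (Fin n) := (List.finRange n).map fun j => (j, false)

lemma occ_fullWord (n : ℕ) (j : Fin n) : LWord.occ j (fullWord n) = 1 := by
  have : (fullWord n).map Prod.fst = List.finRange n := by
    simp [fullWord, Function.comp_def]
  rw [LWord.occ, this]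
  exact List.count_eq_one_of_mem (List.nodup_finRange n) (List.mem_finRange j)

lemma barPlus_induction {n : DeltaHPlus} (p : Submodule k ((barPlus k A).obj n))
    (h : ∀ a : Fin n.len → A, PiTensorProduct.tprod k a ∈ p) (x : (barPlus k A).obj n) : x ∈ p := by
  induction x using PiTensorProduct.induction_on with
  | smul_tprod r a => exact p.smul_mem r (h a)
  | add x y hx hy => exact p.add_mem hx hy

/-- Pure tensors span, and any morphism to `[0]` carries a pure tensor to a letter; the increasing
order is an arbitrary choice. -/
lemma letterClass_surjective : Function.Surjective (letterClass k A) := by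
  intro t
  refine constantTensor_induction (bar k A) (LinearMap.range (letterClass k A)) ?_ t
  rintro ⟨⟨n⟩, hn⟩ x
  refine barPlus_induction k ((LinearMap.range (letterClass k A)).comap
    (constantMk (bar k A) ⟨⟨n⟩, hn⟩)) (fun a => ?_) x
  exact ⟨_, (constantMk_tprod k hn a (fullWord n) (occ_fullWord n)).symm⟩

/-- The outer letters `b` and `c` build in the two-sided multiples: `letterClass` is only linear, so
the relation for three letters could not be multiplied afterwards. -/
lemma letterClass_relation (b a₀ a₁ a₂ c : A) :
    letterClass k A (b * (a₀ * a₁ * a₂) * c) = letterClass k A (b * (a₂ * star a₁ * a₀) * c) := by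
  let a : Fin 5 → A := ![b, a₀, a₁, a₂, c]
  have h₁ := constantMk_tprod k (n := 5) (by norm_num) a
    [(0, false), (1, false), (2, false), (3, false), (4, false)] (by decide)
  -- The second word exchanges `a₀` with `a₂` and puts the label `t` on `a₁`.
  have h₂ := constantMk_tprod k (n := 5) (by norm_num) a
    [(0, false), (3, false), (2, true), (1, false), (4, false)] (by decide)
  have := h₁.symm.trans h₂
  simpa [wordProd, starPow, a, mul_assoc] using this

/-- The ideal is described as the additive subgroup generated by the products `b z c` with `z` a
generator, so additivity and the five-letter relation suffice. -/
lemma letterClass_relationIdeal {a : A} (ha : a ∈ relationIdeal A) : letterClass k A a = 0 := by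
  rw [relationIdeal, TwoSidedIdeal.mem_span_iff_mem_addSubgroup_closure] at ha
  induction ha using AddSubgroup.closure_induction with
  | mem x hx =>
    obtain ⟨_, ⟨b, -, _, ⟨a₀, a₁, a₂, rfl⟩, rfl⟩, c, -, rfl⟩ := hx
    beta_reduce
    rw [mul_sub, sub_mul, map_sub, letterClass_relation, sub_self]
  | zero => exact map_zero _
  | add x y _ _ hx hy => rw [map_add, hx, hy, add_zero]
  | neg x _ hx => rw [map_neg, hx, neg_zero]

/-! ### The quotient algebra -/

lemma mk_relation (a₀ a₁ a₂ : A) : (relationIdeal A).ringCon.mk' (a₀ * a₁ * a₂) =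
    (relationIdeal A).ringCon.mk' (a₂ * star a₁ * a₀) := by
  refine (RingCon.eq _).2 ((TwoSidedIdeal.rel_iff _ _ _).2 ?_)
  exact TwoSidedIdeal.subset_span ⟨a₀, a₁, a₂, rfl⟩

/-- The relation with `a₀ = a₂ = 1`. -/
lemma mk_star (a : A) :
    (relationIdeal A).ringCon.mk' (star a) = (relationIdeal A).ringCon.mk' a := by
  simpa using (mk_relation 1 a 1).symm

/-- Commutativity is the relation with `a₁ = 1`, since `1` is fixed by the involution. It allows
products over unordered index sets below. -/
instance : CommRing (RelationQuotient A) where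
  mul_comm x y := by
    obtain ⟨a, rfl⟩ := RingCon.mk'_surjective _ x
    obtain ⟨b, rfl⟩ := RingCon.mk'_surjective _ y
    rw [← map_mul, ← map_mul]
    simpa using mk_relation a 1 b

/-- With commutativity and trivial involution, only the multiplicities of the letters matter.
Arbitrary multiplicities are allowed because a single fibre of a morphism contains only some of the
letters. -/
lemma mk_wordProd {n : ℕ} (a : Fin n → A) (w : LWord (Fin n)) :
    (relationIdeal A).ringCon.mk' (wordProd a w) =
      ∏ j, (relationIdeal A).ringCon.mk' (a j) ^ LWord.occ j w := by
  induction w with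
  | nil => simp [wordProd, LWord.occ]
  | cons p w ih =>
    have h : (relationIdeal A).ringCon.mk' (starPow (a p.1) p.2) =
        (relationIdeal A).ringCon.mk' (a p.1) := by
      cases p.2
      · rfl
      · exact mk_star _
    simp only [wordProd_cons, map_mul, ih, h, occ_cons, pow_add, Finset.prod_mul_distrib]
    rw [mul_comm]
    congr 1
    simp [pow_ite]

variable (A) in
/-- The projection `A → A / (a₀a₁a₂ - a₂ā₁a₀)` as a linear map. -/
def relationMk : A →ₗ[k] RelationQuotient A where
  toFun := (relationIdeal A).ringCon.mk'
  map_add' := map_add _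
  map_smul' _ _ := rfl

variable (A) in
/-- The map `A^{⊗ n} → A / (a₀a₁a₂ - a₂ā₁a₀)` multiplying all the factors. -/
def multiplyAll (n : DeltaHPlus) : (barPlus k A).obj n →ₗ[k] RelationQuotient A :=
  PiTensorProduct.lift ((MultilinearMap.mkPiAlgebra k (Fin n.len) (RelationQuotient A)).compLinearMap
    fun _ => relationMk k A)

lemma multiplyAll_tprod {n : DeltaHPlus} (a : Fin n.len → A) :
    multiplyAll k A n (PiTensorProduct.tprod k a) =
      ∏ j, (relationIdeal A).ringCon.mk' (a j) := by
  refine (PiTensorProduct.lift.tprod _).trans ?_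
  simp [relationMk]

/-- Each source letter lies exactly once in exactly one fibre, so multiplying within fibres and then
over all fibres uses each factor once. This is the cocone condition behind `homologyZeroToQuotient`.
-/
lemma multiplyAll_map {n m : DeltaHPlus} (f : n ⟶ m) (x : (barPlus k A).obj n) :
    multiplyAll k A m ((barPlus k A).map f x) = multiplyAll k A n x := by
  have h : multiplyAll k A m ∘ₗ barMap k A f = multiplyAll k A n := by
    refine PiTensorProduct.ext (MultilinearMap.ext fun a => ?_)
    refine (congrArg (multiplyAll k A m) (barMap_tprod k A f a)).trans ?_
    refine (multiplyAll_tprod k _).trans (Eq.trans ?_ (multiplyAll_tprod k a).symm)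
    simp only [mk_wordProd]
    -- With the letter as the outer index, its exponents over the fibres add up to `1` by `occ_sum`.
    rw [Finset.prod_comm]
    simp only [Finset.prod_pow_eq_pow_sum, f.occ_sum, pow_one]
  exact LinearMap.congr_fun h x

/-! ### The map back to the quotient algebra, and bijectivity of the comparison maps. -/

variable (A) in
/-- The map `H_0(ΔH₊, H_{A+}) → A / (a₀a₁a₂ - a₂ā₁a₀)` multiplying the factors. -/
def homologyZeroToQuotient : HOPlus k A 0 →ₗ[k] RelationQuotient A :=
  homologyZeroDesc (barPlus k A) (multiplyAll k A) (multiplyAll_map k)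

lemma homologyZeroToQuotient_letter (a : A) :
    homologyZeroToQuotient k A (vertexClass (barPlus k A) ⟨1⟩ (letter k a)) =
      (relationIdeal A).ringCon.mk' a := by
  refine (homologyZeroDesc_vertexClass _ _ _ _ _).trans ?_
  refine (multiplyAll_tprod k (n := ⟨1⟩) fun _ => a).trans ?_
  exact Fin.prod_univ_one _

lemma tensorToHomology_letterClass (a : A) :
    tensorToHomology deltaHInclusion (barPlus k A) (letterClass k A a) =
      vertexClass (barPlus k A) ⟨1⟩ (letter k a) := by
  rw [letterClass_apply]
  exact tensorToHomology_constantMk deltaHInclusion (barPlus k A) ⟨⟨1⟩, Nat.one_pos⟩ (letter k a)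

/-- The analogue of `constantMk_tprod` over `ΔH₊`, where `n = 0` is allowed. -/
lemma vertexClass_tprod {n : ℕ} (a : Fin n → A) (w : LWord (Fin n))
    (h : ∀ j, LWord.occ j w = 1) :
    vertexClass (barPlus k A) ⟨n⟩ (PiTensorProduct.tprod k a) =
      vertexClass (barPlus k A) ⟨1⟩ (letter k (wordProd a w)) := by
  rw [← map_wordHom k w h]
  exact vertexClass_map _ _ _

/-- This is where the initial object is seen to add nothing: for `n = 0` the empty word has product
`1`, so the generator at `[-1]` becomes the letter `1`. -/
lemma homologyZero_letter (t : HOPlus k A 0) :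
    ∃ a : A, vertexClass (barPlus k A) ⟨1⟩ (letter k a) = t := by
  -- Membership in the range of a linear map is used so that `homologyZero_induction` applies.
  suffices h : t ∈ LinearMap.range
      (tensorToHomology deltaHInclusion (barPlus k A) ∘ₗ letterClass k A) by
    obtain ⟨a, rfl⟩ := h
    exact ⟨a, (tensorToHomology_letterClass k a).symm⟩
  refine homologyZero_induction (barPlus k A) _ ?_ t
  rintro ⟨n⟩ x
  refine barPlus_induction k ((LinearMap.range
    (tensorToHomology deltaHInclusion (barPlus k A) ∘ₗ letterClass k A)).comap
      (vertexClass (barPlus k A) ⟨n⟩)) (fun a => ?_) x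
  refine ⟨wordProd a (fullWord n), ?_⟩
  rw [vertexClass_tprod k a _ (occ_fullWord n)]
  exact tensorToHomology_letterClass k _

/-- A vanishing class is detected by following it through `H_0(ΔH₊, H_{A+})` to the quotient, where
it becomes the residue of `a`; the converse is `letterClass_relationIdeal`. -/
lemma letterClass_eq_zero_iff (a : A) :
    letterClass k A a = 0 ↔ (relationIdeal A).ringCon.mk' a = 0 := by
  constructor
  · intro h
    rw [← homologyZeroToQuotient_letter k, ← tensorToHomology_letterClass, h, map_zero, map_zero]
  · intro h
    refine letterClass_relationIdeal k ?_
    rw [← map_zero (relationIdeal A).ringCon.mk'] at h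
    exact (TwoSidedIdeal.mem_iff _ _).2 ((RingCon.eq _).1 h)

/-- Both sides are images of `A`. If a letter dies in homology, then its residue vanishes in the
quotient algebra, hence so does its class in the tensor product. -/
lemma tensorToHomology_bijective :
    Function.Bijective (tensorToHomology deltaHInclusion (barPlus k A)) := by
  constructor
  · refine (injective_iff_map_eq_zero _).2 fun t ht => ?_
    obtain ⟨a, rfl⟩ := letterClass_surjective k t
    rw [letterClass_eq_zero_iff, ← homologyZeroToQuotient_letter k, ← tensorToHomology_letterClass,
      ht, map_zero]
  · intro t
    obtain ⟨a, rfl⟩ := homologyZero_letter k t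
    exact ⟨_, tensorToHomology_letterClass k a⟩

lemma homologyZeroToQuotient_bijective : Function.Bijective (homologyZeroToQuotient k A) := by
  constructor
  · refine (injective_iff_map_eq_zero _).2 fun t ht => ?_
    obtain ⟨a, rfl⟩ := homologyZero_letter k t
    rw [homologyZeroToQuotient_letter, ← letterClass_eq_zero_iff k] at ht
    rw [← tensorToHomology_letterClass, ht, map_zero]
  · intro x
    obtain ⟨a, rfl⟩ := RingCon.mk'_surjective _ x
    exact ⟨_, homologyZeroToQuotient_letter k a⟩

variable (A) in
lemma comparisonZero_bijective : Function.Bijective (comparisonZero k A) :=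
  (tensorToHomology_bijective k).comp (torZero_bijective (constantModule k DeltaH) (bar k A))

variable (A) in
/-- The isomorphism `HO_0(A) ≅ A / (a₀a₁a₂ - a₂ā₁a₀)`. -/
def hoZeroEquiv : HO k A 0 ≃ₗ[k] RelationQuotient A :=
  LinearEquiv.ofBijective (homologyZeroToQuotient k A ∘ₗ comparisonZero k A)
    ((homologyZeroToQuotient_bijective k).comp (comparisonZero_bijective k A))

lemma comparisonZero_hoZeroEquiv_symm (a : A) :
    comparisonZero k A ((hoZeroEquiv k A).symm ((relationIdeal A).ringCon.mk' a)) =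
      vertexClass (barPlus k A) ⟨1⟩ (letter k a) := by
  -- Both sides are compared in the quotient algebra, where `hoZeroEquiv` cancels its inverse by
  -- construction.
  apply (homologyZeroToQuotient_bijective k).injective
  rw [homologyZeroToQuotient_letter]
  exact (hoZeroEquiv k A).apply_symm_apply _

/-! ### The Pontryagin product in degree zero. -/

/-- The Pontryagin product of vertices is given by juxtaposition. -/
lemma pontryagin_vertexClass (n m : DeltaHPlus) (x : (barPlus k A).obj n)
    (y : (barPlus k A).obj m) :
    pontryagin k A 0 0 (vertexClass (barPlus k A) n x) (vertexClass (barPlus k A) m y) =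
      vertexClass (barPlus k A) (DeltaHPlus.sumFunctor.obj (n, m)) (juxtapose k A n m x y) := by
  -- The target degree `0 + 0` of the product reduces to `0` by computation, so no transport is
  -- needed.
  refine (homologyProduct_class (barProduct k A) 0 0 0 _ _).trans ?_
  refine congrArg (homologyClass (gabrielZisman (barPlus k A)) 0) (Subtype.ext ?_)
  -- The only `(0,0)`-shuffle is the trivial one, with sign `1`.
  refine (chainProduct_zero (barProduct k A) _ _).trans ?_
  exact gzMul_vertex (barPlus k A) DeltaHPlus.sumFunctor (juxtapose k A) n m x y

/-- The product lands at `[0] ⊔ [0] = [1]` as `a ⊗ b`; the morphism to `[0]` with increasing order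
and trivial labels identifies this class with that of `ab`. -/
lemma pontryagin_letter (a b : A) :
    pontryagin k A 0 0 (vertexClass (barPlus k A) ⟨1⟩ (letter k a))
        (vertexClass (barPlus k A) ⟨1⟩ (letter k b)) =
      vertexClass (barPlus k A) ⟨1⟩ (letter k (a * b)) := by
  rw [pontryagin_vertexClass]
  refine (congrArg (vertexClass (barPlus k A) ⟨1 + 1⟩)
    (juxtapose_tprod k A ⟨1⟩ ⟨1⟩ (fun _ => a) (fun _ => b))).trans ?_
  refine (vertexClass_tprod k (n := 2) _ [(0, false), (1, false)] (by decide)).trans ?_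
  have h : wordProd (Fin.append (fun _ : Fin 1 => a) fun _ : Fin 1 => b)
      [(0, false), (1, false)] = a * b := by
    simp [wordProd, starPow, Fin.append, Fin.addCases]
  exact congrArg (fun z => vertexClass (barPlus k A) ⟨1⟩ (letter k z)) h

end BarZero

end

end HyperoctahedralHomology

theorem mainTheorem6 (k : Type u) [CommRing k] [Star k] [TrivialStar k]
    (A : Type u) [Ring A] [Algebra k A] [StarRing A] [StarModule k A] :
    Function.Bijective (comparisonZero k A) ∧
    ∃ Φ : RelationQuotient A ≃ₗ[k] HO k A 0,
      (∀ a : A, comparisonZero k A (Φ ((relationIdeal A).ringCon.mk' a)) =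
        vertexClass (barPlus k A) ⟨1⟩ (PiTensorProduct.tprod k fun _ : Fin 1 => a)) ∧
      ∀ x y : RelationQuotient A,
        comparisonZero k A (Φ (x * y)) =
          pontryagin k A 0 0 (comparisonZero k A (Φ x)) (comparisonZero k A (Φ y)) := by
  refine ⟨comparisonZero_bijective k A, (hoZeroEquiv k A).symm,
    comparisonZero_hoZeroEquiv_symm k, fun x y => ?_⟩
  -- Lifting to `A` turns multiplicativity into the statement about letters, since `Φ` is known on
  -- residues of elements of `A`.
  obtain ⟨a, rfl⟩ := RingCon.mk'_surjective _ x
  obtain ⟨b, rfl⟩ := RingCon.mk'_surjective _ y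
  rw [← map_mul, comparisonZero_hoZeroEquiv_symm, comparisonZero_hoZeroEquiv_symm,
    comparisonZero_hoZeroEquiv_symm, pontryagin_letter]
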